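/- Let $S,A$ be finite sets and consider a discounted Markov decision process with transition probabilities $P_{st}^a$ ($P_{st}^a\ge 0$, $\sum_t P_{st}^a=1$), rewards $r_s^a\in\mathbb R$ and discount factor $0<\gamma<1$. A policy is a $\pi\in\mathbb R^{S\times A}$ with $\pi_s^a\ge 0$ and $\sum_a\pi_s^a=1$ for every $s$; it is positive if all $\pi_s^a>0$. Let $\mu$ be a positive policy (the prior), $\tau>0$, and let $\phi:(0,\infty)\to\mathbb R$ be convex and twice continuously differentiable, strongly convex on $(0,M]$ for every $M>0$ (with a modulus that may depend on $M$), with $\phi(1)=0$ and $\phi'(x)\to-\infty$ as $x\to0^+$; put $\phi(0)=\lim_{x\to0^+}\phi(x)\in(-\infty,+\infty]$. For a policy $\pi$ let $$(h_\pi)_s=\sum_a\mu_s^a\,\phi(\pi_s^a/\mu_s^a),\quad (P_\pi)_{st}=\sum_a\pi_s^aP_{st}^a,\quad (r_\pi)_s=\sum_a\pi_s^ar_s^a,$$ and, if $h_\pi$ is finite, $v_\pi=(I-\gamma P_\pi)^{-1}(r_\pi-\tau h_\pi)$. A policy $\pi^*$ with finite $h_{\pi^*}$ is called optimal if $(v_{\pi^*})_s\ge(v_\pi)_s$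 for every state $s$ and every policy $\pi$ with finite $h_\pi$. The quasi-Newton flow is the system, for positive policies $\pi(t)$, $t\ge0$, $$\frac{\mathrm d\pi_s^a}{\mathrm dt}=\frac{\mu_s^a}{\tau\,\phi''(\pi_s^a/\mu_s^a)}\Big(r_s^a-\tau\phi'(\pi_s^a/\mu_s^a)-[(I-\gamma P^a)v_\pi]_s+c_s\Big),$$ where $(P^av)_s=\sum_tP_{st}^av_t$ and $c_s=c_s(t)$ is the multiplier of the constraint $\sum_a\pi_s^a=1$. Then there is a unique optimal policy $\pi^*$, and the flow converges to it globally: for every positive policy $\pi_0$ the flow has a solution $\pi:[0,\infty)\to\mathbb R^{S\times A}$ with $\pi(0)=\pi_0$, and every solution $\pi$ on $[0,\infty)$ satisfies $\pi(t)\to\pi^*$ as $t\to\infty$. -/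

import Mathlib

open Set Filter Topology

/-- A finite discounted Markov decision process with state space `S` and action space `A`:
`P s a t` is the probability of moving from `s` to `t` under action `a`, `r s a` is the reward. -/
structure MDP (S A : Type*) [Fintype S] where
  P : S → A → S → ℝ
  r : S → A → ℝ
  γ : ℝ
  P_nonneg : ∀ s a t, 0 ≤ P s a t
  P_sum : ∀ s a, ∑ t, P s a t = 1
  γ_pos : 0 < γ
  γ_lt_one : γ < 1

/-- `π s` is a probability distribution over the actions, for every state `s`. -/
def IsPolicy {S A : Type*} [Fintype A] (π : S → A → ℝ) : Prop :=
  (∀ s a, 0 ≤ π s a) ∧ ∀ s, ∑ a, π s a = 1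

/-- A policy all of whose action probabilities are positive. -/
def IsPosPolicy {S A : Type*} [Fintype A] (π : S → A → ℝ) : Prop :=
  IsPolicy π ∧ ∀ s a, 0 < π s a

/-- The standing assumptions on the function `φ : (0, ∞) → ℝ` generating the `f`-divergence
(values of `φ` outside `(0, ∞)` are irrelevant). Strong convexity is only asked on the bounded
intervals `(0, M]`, with a modulus that may depend on `M`; this covers functions that are strongly
convex on all of `(0, ∞)`, and also `x log x` and the generators of the `α`-divergences. -/
structure IsEntropyFunction (φ : ℝ → ℝ) : Prop where
  convexOn : ConvexOn ℝ (Ioi 0) φ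
  map_one : φ 1 = 0
  contDiffOn : ContDiffOn ℝ 2 φ (Ioi 0)
  strongConvexOn : ∀ M : ℝ, 0 < M → ∃ m : ℝ, 0 < m ∧ StrongConvexOn (Ioc 0 M) m φ
  tendsto_deriv : Tendsto (deriv φ) (𝓝[>] 0) atBot

/-- The limit of `φ` at `0` from the right exists as a finite number. (For a convex `φ` the only
alternative is that the limit is `+∞`.) -/
def FiniteAtZero (φ : ℝ → ℝ) : Prop :=
  ∃ l : ℝ, Tendsto φ (𝓝[>] 0) (𝓝 l)

/-- `φ` with the usual convention `φ(0) = lim_{x → 0+} φ(x)`; only meaningful at `0` when that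
limit is finite. -/
noncomputable def extZero (φ : ℝ → ℝ) (x : ℝ) : ℝ :=
  open Classical in if x = 0 then limUnder (𝓝[>] (0 : ℝ)) φ else φ x

/-- A policy whose `f`-divergence regularizer is finite in every state: either no action
probability vanishes or `φ(0+)` is finite. -/
def IsAdmissible {S A : Type*} [Fintype A] (φ : ℝ → ℝ) (π : S → A → ℝ) : Prop :=
  IsPolicy π ∧ ∀ s a, π s a = 0 → FiniteAtZero φ

/-- The `f`-divergence `(h_π)_s = ∑ a, μ s a * φ (π s a / μ s a)`. -/
noncomputable def fDivReg {S A : Type*} [Fintype A] (φ : ℝ → ℝ) (μ π : S → A → ℝ) : S → ℝ :=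
  fun s => ∑ a, μ s a * extZero φ (π s a / μ s a)

namespace MDP

variable {S A : Type*} [Fintype S] [Fintype A]

/-- The transition matrix `P_π`. -/
def policyMatrix (M : MDP S A) (π : S → A → ℝ) : Matrix S S ℝ :=
  Matrix.of fun s t => ∑ a, π s a * M.P s a t

/-- The reward vector `r_π`. -/
def policyReward (M : MDP S A) (π : S → A → ℝ) : S → ℝ :=
  fun s => ∑ a, π s a * M.r s a

/-- The regularized value function `v_π = (I - γ P_π)⁻¹ (r_π - τ h_π)`. The matrix is invertible
for every policy. -/
noncomputable def value [DecidableEq S] (M : MDP S A) (τ : ℝ) (φ : ℝ → ℝ) (μ π : S → A → ℝ) :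
    S → ℝ :=
  Matrix.mulVec (1 - M.γ • M.policyMatrix π)⁻¹ (M.policyReward π - τ • fDivReg φ μ π)

/-- `π` is optimal: its value dominates the value of every other policy in every state. Policies
with an infinite regularizer have value `-∞` in some state and are not competitors. -/
def IsOptimal [DecidableEq S] (M : MDP S A) (τ : ℝ) (φ : ℝ → ℝ) (μ π : S → A → ℝ) : Prop :=
  IsAdmissible φ π ∧
    ∀ π' : S → A → ℝ, IsAdmissible φ π' → ∀ s, M.value τ φ μ π' s ≤ M.value τ φ μ π s

/-- The right-hand side of the quasi-Newton flow at the policy `π`, with multipliers `c`: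
`μ (φ''(π/μ))⁻¹ (r - τ φ'(π/μ) - [(I - γ P^a) v_π]_s + c_s) / τ`. -/
noncomputable def flowField [DecidableEq S] (M : MDP S A) (τ : ℝ) (φ : ℝ → ℝ) (μ π : S → A → ℝ)
    (c : S → ℝ) (s : S) (a : A) : ℝ :=
  μ s a * (deriv (deriv φ) (π s a / μ s a))⁻¹ *
    (M.r s a - τ * deriv φ (π s a / μ s a)
      - (M.value τ φ μ π s - M.γ * ∑ t, M.P s a t * M.value τ φ μ π t) + c s) / τ

/-- `π` solves the quasi-Newton flow on `[0, ∞)`: it takes values in the positive policies (the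
domain of the right-hand side) and satisfies the differential equation, where the numbers `c s` are
the multipliers of the constraints `∑ a, π s a = 1` (at each time these constraints leave exactly
one choice of `c`). The derivative at time `0` is one-sided. -/
def IsQuasiNewtonFlow [DecidableEq S] (M : MDP S A) (τ : ℝ) (φ : ℝ → ℝ) (μ : S → A → ℝ)
    (π : ℝ → S → A → ℝ) : Prop :=
  ∀ t : ℝ, 0 ≤ t → IsPosPolicy (π t) ∧
    ∃ c : S → ℝ, ∀ s a,
      HasDerivWithinAt (fun u => π u s a) (M.flowField τ φ μ (π t) c s a) (Ici 0) t

end MDP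

/-!
The flow is linear in the dual variable `y = φ'(π / μ)`: it reads `y' = -y + q / τ + k`, where
`q s a = r s a + γ (P^a v_π)_s` are the state-action values of the current policy and the unknown
`k s` does not depend on the action. So `y` relaxes towards `q / τ` up to constants in each state,
and `π` is recovered from `y` modulo such constants by the mirror map of the regularizer
(`IsMirrorImage`). This map is well defined, with values in the interior of the simplex, because
`φ' → -∞` at `0`, and it is Lipschitz because `φ` is strongly convex on bounded intervals
(`exists_lipschitz_mirror`).

*Monotonicity.* Along the flow the derivative of the Bellman operator of `π`, applied to the current
value function, is a weighted sum of squares. The minimum principle for `I - γ P_π` shows that every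
component of `v_π` increases (`MDP.value_le_value_of_flow`); since `h_π ≥ 0`, it is bounded above.

*Convergence.* Hence `v_π` has a limit, so has `q`, so has the centred dual variable, and therefore
`π` converges to a policy `ρ` which is the mirror image of `q / τ` for its own state-action values
(`MDP.IsQuasiNewtonFlow.exists_tendsto_greedy`). Such a policy maximizes the regularized Bellman
operator at its own value function, strictly by strict convexity of `φ`
(`MDP.policyBackup_le_greedy`), so that it is the unique optimal policy. In particular all solutions
have the same limit, and existence of an optimal policy follows from existence of a solution.

*Existence.* For an arbitrary choice of additive constants, `z' = -z + q / τ` is an equation with a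
locally Lipschitz right-hand side, although the flow for `π` itself contains `1 / φ''`, which is only
continuous. Truncating the right-hand side makes it bounded and globally Lipschitz, and the
monotonicity of `v_π` gives an a priori bound below the truncation level
(`MDP.exists_isQuasiNewtonFlow`).
-/

/-! ### Entropy functions -/

namespace IsEntropyFunction

variable {φ : ℝ → ℝ} (hφ : IsEntropyFunction φ)
include hφ

theorem hasDerivAt {x : ℝ} (hx : 0 < x) : HasDerivAt φ (deriv φ x) x :=
  ((hφ.contDiffOn.differentiableOn (by norm_num)).differentiableAt
    (Ioi_mem_nhds hx)).hasDerivAt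

theorem contDiffOn_deriv : ContDiffOn ℝ 1 (deriv φ) (Ioi 0) :=
  hφ.contDiffOn.deriv_of_isOpen isOpen_Ioi (by norm_num)

theorem hasDerivAt_deriv {x : ℝ} (hx : 0 < x) : HasDerivAt (deriv φ) (deriv (deriv φ) x) x :=
  ((hφ.contDiffOn_deriv.differentiableOn (by norm_num)).differentiableAt
    (Ioi_mem_nhds hx)).hasDerivAt

theorem continuousOn_deriv : ContinuousOn (deriv φ) (Ioi 0) :=
  hφ.contDiffOn_deriv.continuousOn

/-- Strong convexity of `φ` on `(0, M]`, expressed by its derivative. -/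
theorem exists_strong_mono (M : ℝ) : ∃ m : ℝ, 0 < m ∧ ∀ x y : ℝ, 0 < x → x ≤ y → y ≤ M →
    m * (y - x) ≤ deriv φ y - deriv φ x := by
  obtain ⟨m, hm, hs⟩ := hφ.strongConvexOn (max M 0 + 1) (by positivity)
  refine ⟨m, hm, fun x y hx hxy hyM => ?_⟩
  rw [strongConvexOn_iff_convex] at hs
  have hy : 0 < y := hx.trans_le hxy
  have hd : ∀ z : ℝ, 0 < z → HasDerivAt (fun x => φ x - m / 2 * ‖x‖ ^ 2) (deriv φ z - m * z) z := by
    intro z hz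
    have h := (hφ.hasDerivAt hz).sub (((hasDerivAt_id z).pow 2).const_mul (m / 2))
    simp only [Real.norm_eq_abs, sq_abs]
    refine h.congr_deriv ?_
    simp
    ring
  have hc := hs.subset (s := Ioo 0 (max M 0 + 1)) Ioo_subset_Ioc_self (convex_Ioo _ _)
  have hmono := hc.monotoneOn_deriv (fun z hz => (hd z hz.1).differentiableAt)
  have h := hmono (a := x) (b := y) ⟨hx, by linarith [le_max_left M 0]⟩
    ⟨hy, by linarith [le_max_left M 0]⟩ hxy
  rw [(hd x hx).deriv, (hd y hy).deriv] at h
  linarith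

theorem deriv_strictMonoOn : StrictMonoOn (deriv φ) (Ioi 0) := by
  intro x hx y _ hxy
  obtain ⟨m, hm, h⟩ := hφ.exists_strong_mono y
  nlinarith [h x y hx hxy.le le_rfl]

theorem deriv_deriv_pos {x : ℝ} (hx : 0 < x) : 0 < deriv (deriv φ) x := by
  obtain ⟨m, hm, h⟩ := hφ.exists_strong_mono (x + 1)
  have ht := (hasDerivAt_iff_tendsto_slope.1 (hφ.hasDerivAt_deriv hx))
  have ht' := ht.mono_left (nhdsWithin_mono x (fun y (hy : y ∈ Ioi x) => ne_of_gt hy))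
  refine hm.trans_le (ge_of_tendsto ht' ?_)
  filter_upwards [Ioo_mem_nhdsGT (show x < x + 1 by linarith)] with y hy
  rw [slope_def_field, le_div_iff₀ (by linarith [hy.1])]
  exact h x y hx hy.1.le hy.2.le

theorem tangent_lt {x y : ℝ} (hx : 0 < x) (hy : 0 < y) (hxy : x ≠ y) :
    φ x + deriv φ x * (y - x) < φ y := by
  have hs : StrictConvexOn ℝ (Ioi 0) φ := by
    refine StrictMonoOn.strictConvexOn_of_deriv (convex_Ioi 0) hφ.contDiffOn.continuousOn ?_
    rw [interior_Ioi]
    exact hφ.deriv_strictMonoOn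
  rcases lt_or_gt_of_ne hxy with h | h
  · have := hs.deriv_lt_slope hx hy h (hφ.hasDerivAt hx).differentiableAt
    rw [slope_def_field, lt_div_iff₀ (by linarith)] at this
    linarith
  · have := hs.slope_lt_deriv hy hx h (hφ.hasDerivAt hx).differentiableAt
    rw [slope_def_field, div_lt_iff₀ (by linarith)] at this
    linarith

theorem tangent_le {x y : ℝ} (hx : 0 < x) (hy : 0 < y) :
    φ x + deriv φ x * (y - x) ≤ φ y := by
  rcases eq_or_ne x y with rfl | h
  · simp
  · exact (hφ.tangent_lt hx hy h).le

/-- The strict tangent inequality, extended to the end point `y = 0` when `φ(0+)` is finite. -/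
theorem tangent_lt_extZero {x y : ℝ} (hx : 0 < x) (hy : 0 ≤ y) (h0 : y = 0 → FiniteAtZero φ)
    (hxy : x ≠ y) : φ x + deriv φ x * (y - x) < extZero φ y := by
  rcases hy.eq_or_lt with rfl | hy
  · obtain ⟨l, hl⟩ := h0 rfl
    rw [extZero, if_pos rfl, hl.limUnder_eq]
    -- comparing with the tangent at `x / 2` keeps the inequality strict in the limit `y → 0`
    have h1 : φ (x / 2) + deriv φ (x / 2) * (0 - x / 2) ≤ l := by
      have hc : Tendsto (fun y => φ (x / 2) + deriv φ (x / 2) * (y - x / 2)) (𝓝[>] 0)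
          (𝓝 (φ (x / 2) + deriv φ (x / 2) * (0 - x / 2))) :=
        (Continuous.tendsto (by fun_prop) 0).mono_left nhdsWithin_le_nhds
      refine le_of_tendsto_of_tendsto hc hl ?_
      filter_upwards [self_mem_nhdsWithin] with y hy
      exact hφ.tangent_le (by positivity) hy
    have h2 := hφ.tangent_lt hx (half_pos hx) (by linarith)
    have h3 := hφ.deriv_strictMonoOn (a := x / 2) (b := x) (half_pos hx) hx (by linarith)
    nlinarith
  · rw [extZero, if_neg hy.ne']
    exact hφ.tangent_lt hx hy hxy

theorem tangent_le_extZero {x y : ℝ} (hx : 0 < x) (hy : 0 ≤ y) (h0 : y = 0 → FiniteAtZero φ) :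
    φ x + deriv φ x * (y - x) ≤ extZero φ y := by
  rcases eq_or_ne x y with rfl | h
  · simp [extZero, hx.ne']
  · exact (hφ.tangent_lt_extZero hx hy h0 h).le

/-- The derivative `φ'` takes all values below a given one, as it is continuous and tends to `-∞` at
`0`. -/
theorem exists_deriv_eq_sub {p d : ℝ} (hp : 0 < p) (hd : 0 ≤ d) :
    ∃ x, 0 < x ∧ x ≤ p ∧ deriv φ x = deriv φ p - d := by
  have h1 : ∀ᶠ x in 𝓝[>] (0 : ℝ), deriv φ x ≤ deriv φ p - d :=
    hφ.tendsto_deriv.eventually (eventually_le_atBot _)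
  obtain ⟨a, ha, ha0, hap⟩ := (h1.and (Ioo_mem_nhdsGT hp)).exists
  obtain ⟨x, hx, hxe⟩ := intermediate_value_Icc hap.le
    (hφ.continuousOn_deriv.mono fun y hy => ha0.trans_le hy.1) ⟨ha, by linarith⟩
  exact ⟨x, ha0.trans_le hx.1, hx.2, hxe⟩

/-- On a bounded part of `(0, ∞)`, `φ` is Lipschitz with respect to any bound on `φ'`. -/
theorem abs_sub_le {x y Y : ℝ} (hx : 0 < x) (hy : 0 < y) (hxY : |deriv φ x| ≤ Y)
    (hyY : |deriv φ y| ≤ Y) : |φ x - φ y| ≤ Y * |x - y| := by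
  have h1 := hφ.tangent_le hx hy
  have h2 := hφ.tangent_le hy hx
  have h3 : |deriv φ x * (y - x)| ≤ Y * |x - y| := by
    rw [abs_mul, abs_sub_comm y x]
    gcongr
  have h4 : |deriv φ y * (x - y)| ≤ Y * |x - y| := by
    rw [abs_mul]
    gcongr
  rw [abs_le] at *
  constructor <;> linarith

end IsEntropyFunction

/-! ### The mirror map of the regularizer -/

theorem IsEntropyFunction.exists_mul_abs_sub_le {φ : ℝ → ℝ} (hφ : IsEntropyFunction φ) (M : ℝ) :
    ∃ m : ℝ, 0 < m ∧ ∀ x y : ℝ, 0 < x → x ≤ M → 0 < y → y ≤ M →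
      m * |x - y| ≤ |deriv φ x - deriv φ y| := by
  obtain ⟨m, hm, h⟩ := hφ.exists_strong_mono M
  refine ⟨m, hm, fun x y hx hxM hy hyM => ?_⟩
  rcases le_total x y with hxy | hxy
  · rw [abs_sub_comm x, abs_sub_comm (deriv φ x), abs_of_nonneg (sub_nonneg.2 hxy)]
    exact (h x y hx hxy hyM).trans (le_abs_self _)
  · rw [abs_of_nonneg (sub_nonneg.2 hxy)]
    exact (h y x hy hxy hxM).trans (le_abs_self _)

section Simplex

variable {A : Type*} [Fintype A] {φ : ℝ → ℝ} (hφ : IsEntropyFunction φ)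
  {w : A → ℝ} (hw : ∀ a, 0 < w a)
include hφ hw

/-- Every dual vector `z` has a mirror image in the simplex. For a coordinate `b` at which `z` is
largest, prescribing the ratio `q = p b / w b` determines all other ratios, and these are at most
`q`; the total mass is at most `1` for `q = 1` and at least `1` for `q = 1 / w b`. -/
theorem exists_simplex_dual (hw1 : ∑ a, w a = 1) (z : A → ℝ) :
    ∃ (p : A → ℝ) (l : ℝ), (∀ a, 0 < p a) ∧ ∑ a, p a = 1 ∧
      ∀ a, deriv φ (p a / w a) = z a + l := by
  have hne : Nonempty A := by
    by_contra h
    rw [not_nonempty_iff] at h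
    simp at hw1
  obtain ⟨b, hb⟩ := Finite.exists_max z
  have hex : ∀ (q : ℝ) (a : A), ∃ x : ℝ, 0 < q →
      0 < x ∧ x ≤ q ∧ deriv φ x = deriv φ q - (z b - z a) := by
    intro q a
    by_cases hq : 0 < q
    · obtain ⟨x, hx⟩ := hφ.exists_deriv_eq_sub hq (sub_nonneg.2 (hb a))
      exact ⟨x, fun _ => hx⟩
    · exact ⟨0, fun h => absurd h hq⟩
  choose ξ hξ using hex
  have hwb : w b ≤ 1 := by
    rw [← hw1]
    exact Finset.single_le_sum (fun a _ => (hw a).le) (Finset.mem_univ b)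
  have hM : 1 ≤ 1 / w b := by
    rw [le_div_iff₀ (hw b)]
    linarith
  obtain ⟨m, hm, hmon⟩ := hφ.exists_mul_abs_sub_le (1 / w b)
  have hcont : ContinuousOn (fun q => ∑ a, w a * ξ q a) (Icc 1 (1 / w b)) := by
    refine continuousOn_finsetSum _ fun a _ => continuousOn_const.mul ?_
    intro q hq
    have hq0 : 0 < q := one_pos.trans_le hq.1
    rw [ContinuousWithinAt, tendsto_iff_dist_tendsto_zero]
    have hlim : Tendsto (fun q' => |deriv φ q' - deriv φ q| / m) (𝓝[Icc 1 (1 / w b)] q) (𝓝 0) := by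
      have h1 : ContinuousAt (deriv φ) q := hφ.continuousOn_deriv.continuousAt (Ioi_mem_nhds hq0)
      have h2 : ContinuousAt (fun q' => |deriv φ q' - deriv φ q| / m) q := by fun_prop
      have h3 := h2.tendsto.mono_left (nhdsWithin_le_nhds (s := Icc 1 (1 / w b)))
      simpa using h3
    refine squeeze_zero' (Eventually.of_forall fun _ => dist_nonneg) ?_ hlim
    filter_upwards [self_mem_nhdsWithin] with q' hq'
    have hq0' : 0 < q' := one_pos.trans_le hq'.1
    obtain ⟨h1, h2, h3⟩ := hξ q a hq0
    obtain ⟨h1', h2', h3'⟩ := hξ q' a hq0'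
    have := hmon _ _ h1' (h2'.trans hq'.2) h1 (h2.trans hq.2)
    rw [h3, h3', sub_sub_sub_cancel_right] at this
    rw [Real.dist_eq, le_div_iff₀ hm]
    linarith
  have hlow : ∑ a, w a * ξ 1 a ≤ 1 := by
    refine (Finset.sum_le_sum fun a _ => ?_).trans_eq hw1
    nlinarith [(hξ 1 a one_pos).2.1, hw a]
  have hhigh : 1 ≤ ∑ a, w a * ξ (1 / w b) a := by
    have hpos : 0 < 1 / w b := one_pos.trans_le hM
    have hbb : ξ (1 / w b) b = 1 / w b := by
      obtain ⟨h1, -, h3⟩ := hξ (1 / w b) b hpos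
      exact hφ.deriv_strictMonoOn.injOn h1 hpos (by simpa using h3)
    calc (1 : ℝ) = w b * ξ (1 / w b) b := by rw [hbb, mul_one_div_cancel (hw b).ne']
      _ ≤ _ := Finset.single_le_sum
        (f := fun a => w a * ξ (1 / w b) a)
        (fun a _ => mul_nonneg (hw a).le (hξ _ a hpos).1.le) (Finset.mem_univ b)
  obtain ⟨q, hq, hq1⟩ := intermediate_value_Icc hM hcont ⟨hlow, hhigh⟩
  have hq0 : 0 < q := one_pos.trans_le hq.1
  refine ⟨fun a => w a * ξ q a, deriv φ q - z b, fun a => mul_pos (hw a) (hξ q a hq0).1, hq1,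
    fun a => ?_⟩
  rw [mul_div_cancel_left₀ _ (hw a).ne', (hξ q a hq0).2.2]
  ring

/-- If `l` were larger than `l'` by more than the distance between `z` and `z'`, every coordinate of
`p` would exceed that of `p'`, although both sum to one. -/
theorem simplex_multiplier_sub_le {p p' z z' : A → ℝ} {l l' δ : ℝ}
    (hp : ∀ a, 0 < p a) (hp1 : ∑ a, p a = 1) (hp' : ∀ a, 0 < p' a) (hp1' : ∑ a, p' a = 1)
    (h : ∀ a, deriv φ (p a / w a) = z a + l) (h' : ∀ a, deriv φ (p' a / w a) = z' a + l')
    (hδ : ∀ a, |z a - z' a| ≤ δ) : l - l' ≤ δ := by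
  by_contra! hlt
  have hne : (Finset.univ : Finset A).Nonempty := by
    rw [Finset.nonempty_iff_ne_empty]
    intro h0
    rw [h0] at hp1
    simp at hp1
  have : ∑ a, p' a < ∑ a, p a := by
    refine Finset.sum_lt_sum_of_nonempty hne fun a _ => ?_
    have h1 : deriv φ (p' a / w a) < deriv φ (p a / w a) := by
      rw [h, h']
      linarith [(abs_le.1 (hδ a)).1]
    have h2 := (hφ.deriv_strictMonoOn.lt_iff_lt (div_pos (hp' a) (hw a))
      (div_pos (hp a) (hw a))).1 h1
    exact (div_lt_div_iff_of_pos_right (hw a)).1 h2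
  linarith

theorem simplex_abs_deriv_sub_le {p p' z z' : A → ℝ} {l l' δ : ℝ}
    (hp : ∀ a, 0 < p a) (hp1 : ∑ a, p a = 1) (hp' : ∀ a, 0 < p' a) (hp1' : ∑ a, p' a = 1)
    (h : ∀ a, deriv φ (p a / w a) = z a + l) (h' : ∀ a, deriv φ (p' a / w a) = z' a + l')
    (hδ : ∀ a, |z a - z' a| ≤ δ) (a : A) :
    |deriv φ (p a / w a) - deriv φ (p' a / w a)| ≤ 2 * δ := by
  have h1 := simplex_multiplier_sub_le hφ hw hp hp1 hp' hp1' h h' hδ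
  have h2 := simplex_multiplier_sub_le hφ hw hp' hp1' hp hp1 h' h
    (fun a => by rw [abs_sub_comm]; exact hδ a)
  have h3 := abs_le.1 (hδ a)
  rw [h, h', abs_le]
  constructor <;> linarith [h3.1, h3.2]

/-- If the dual vector `z` moves differentiably, so does its mirror image `p`. Nothing is assumed on
the multiplier `l`: its difference quotients are determined by those of `z`, because those of `p`
add up to zero. Since `φ''` is only continuous, this is argued with difference quotients of `φ'`. -/
theorem exists_hasDerivWithinAt_simplex_dual {D : Set ℝ} {t : ℝ} (ht : t ∈ D)
    {z p : ℝ → A → ℝ} {l : ℝ → ℝ} {z' : A → ℝ}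
    (hp : ∀ u ∈ D, ∀ a, 0 < p u a) (hp1 : ∀ u ∈ D, ∑ a, p u a = 1)
    (hd : ∀ u ∈ D, ∀ a, deriv φ (p u a / w a) = z u a + l u)
    (hz : ∀ a, HasDerivWithinAt (fun u => z u a) (z' a) D t)
    (hc : ∀ a, ContinuousWithinAt (fun u => p u a) D t) :
    ∃ k : ℝ, ∀ a, HasDerivWithinAt (fun u => p u a)
      (w a * (deriv (deriv φ) (p t a / w a))⁻¹ * (z' a + k)) D t := by
  have hx : ∀ u ∈ D, ∀ a, 0 < p u a / w a := fun u hu a => div_pos (hp u hu a) (hw a)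
  -- the difference quotient of `φ'` between the values at `t` and `u`
  set E : A → ℝ → ℝ := fun a u => dslope (deriv φ) (p t a / w a) (p u a / w a) with hE
  have hEt : ∀ a, Tendsto (E a) (𝓝[D \ {t}] t) (𝓝 (deriv (deriv φ) (p t a / w a))) := by
    intro a
    have h1 : ContinuousAt (dslope (deriv φ) (p t a / w a)) (p t a / w a) :=
      continuousAt_dslope_same.2 (hφ.hasDerivAt_deriv (hx t ht a)).differentiableAt
    have h2 : ContinuousWithinAt (fun u => p u a / w a) D t := (hc a).div_const _
    have h3 : ContinuousWithinAt (E a) D t :=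
      ContinuousAt.comp_continuousWithinAt (f := fun u => p u a / w a) h1 h2
    have h4 := h3.tendsto.mono_left (nhdsWithin_mono t (sdiff_subset (t := {t})))
    simpa only [hE, dslope_same] using h4
  have hpos : ∀ a, 0 < deriv (deriv φ) (p t a / w a) := fun a => hφ.deriv_deriv_pos (hx t ht a)
  have hEpos : ∀ u ∈ D, ∀ a, 0 < E a u := by
    intro u hu a
    simp only [hE]
    rcases eq_or_ne (p u a / w a) (p t a / w a) with h | h
    · rw [h, dslope_same]
      exact hpos a
    · rw [dslope_of_ne _ h]
      exact hφ.deriv_strictMonoOn.slope_pos (hx t ht a) (hx u hu a) h.symm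
  have hne : (Finset.univ : Finset A).Nonempty := by
    rw [Finset.nonempty_iff_ne_empty]
    intro h0
    have := hp1 t ht
    rw [h0] at this
    simp at this
  have hsz : ∀ a, Tendsto (slope (fun u => z u a) t) (𝓝[D \ {t}] t) (𝓝 (z' a)) := fun a =>
    hasDerivWithinAt_iff_tendsto_slope.1 (hz a)
  have hwE : ∀ a, Tendsto (fun u => w a * (E a u)⁻¹) (𝓝[D \ {t}] t)
      (𝓝 (w a * (deriv (deriv φ) (p t a / w a))⁻¹)) := fun a =>
    ((hEt a).inv₀ (hpos a).ne').const_mul _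
  have hden : (∑ a, w a * (deriv (deriv φ) (p t a / w a))⁻¹) ≠ 0 :=
    (Finset.sum_pos (fun a _ => mul_pos (hw a) (inv_pos.2 (hpos a))) hne).ne'
  set k : ℝ := -((∑ a, w a * (deriv (deriv φ) (p t a / w a))⁻¹ * z' a) /
    ∑ a, w a * (deriv (deriv φ) (p t a / w a))⁻¹) with hk
  have hsp : ∀ u ∈ D \ {t}, ∀ a, slope (fun u => p u a) t u =
      w a * (E a u)⁻¹ * (slope (fun u => z u a) t u + slope l t u) := by
    intro u hu a
    have h1 := sub_smul_dslope (deriv φ) (p t a / w a) (p u a / w a)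
    rw [hd u hu.1, hd t ht, smul_eq_mul] at h1
    have h2 : (p u a - p t a) * E a u = w a * (z u a - z t a + (l u - l t)) := by
      have h3 : p u a - p t a = w a * (p u a / w a - p t a / w a) := by
        have := (hw a).ne'
        field_simp
      rw [h3, mul_assoc, h1]
      ring
    have h4 : u - t ≠ 0 := sub_ne_zero.2 hu.2
    have h5 := (hEpos u hu.1 a).ne'
    rw [slope_def_field, slope_def_field, slope_def_field]
    field_simp
    linarith
  have hsl : Tendsto (slope l t) (𝓝[D \ {t}] t) (𝓝 k) := by
    have h1 : Tendsto (fun u => -((∑ a, w a * (E a u)⁻¹ * slope (fun u => z u a) t u) /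
        ∑ a, w a * (E a u)⁻¹)) (𝓝[D \ {t}] t) (𝓝 k) :=
      ((tendsto_finsetSum _ fun a _ => (hwE a).mul (hsz a)).div
        (tendsto_finsetSum _ fun a _ => hwE a) hden).neg
    refine h1.congr' ?_
    filter_upwards [self_mem_nhdsWithin] with u hu
    have h2 : ∑ a, slope (fun u => p u a) t u = 0 := by
      simp only [slope_def_field]
      rw [← Finset.sum_div, Finset.sum_sub_distrib, hp1 u hu.1, hp1 t ht]
      simp
    simp only [hsp u hu, mul_add, Finset.sum_add_distrib, ← Finset.sum_mul] at h2
    have h3 : (∑ a, w a * (E a u)⁻¹) ≠ 0 :=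
      (Finset.sum_pos (fun a _ => mul_pos (hw a) (inv_pos.2 (hEpos u hu.1 a))) hne).ne'
    rw [← neg_div, div_eq_iff h3]
    linarith
  refine ⟨k, fun a => ?_⟩
  rw [hasDerivWithinAt_iff_tendsto_slope]
  refine ((hwE a).mul ((hsz a).add hsl)).congr' ?_
  filter_upwards [self_mem_nhdsWithin] with u hu
  exact (hsp u hu a).symm

end Simplex

/-- `π` is the image of the dual variable `z` under the mirror map of the regularizer: in every
state, `π s` is the maximizer of `⟨z s, p⟩ - ∑ a, μ s a * φ (p a / μ s a)` over the probability
vectors `p`. It is expressed by the first order conditions, with a multiplier for the constraint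
`∑ a, p a = 1`. -/
def IsMirrorImage {S A : Type*} [Fintype A] (φ : ℝ → ℝ) (μ z π : S → A → ℝ) : Prop :=
  IsPosPolicy π ∧ ∃ l : S → ℝ, ∀ s a, deriv φ (π s a / μ s a) = z s a + l s

section Mirror

variable {S A : Type*} [Fintype S] [Fintype A] {φ : ℝ → ℝ} (hφ : IsEntropyFunction φ)
  {μ : S → A → ℝ} (hμ : IsPosPolicy μ)

omit [Fintype S] in
theorem IsPosPolicy.le_one {π : S → A → ℝ} (hπ : IsPosPolicy π) (s : S) (a : A) :
    π s a ≤ 1 := by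
  rw [← hπ.1.2 s]
  exact Finset.single_le_sum (fun b _ => hπ.1.1 s b) (Finset.mem_univ a)

omit [Fintype S] in
theorem IsPosPolicy.isMirrorImage {π : S → A → ℝ} (hπ : IsPosPolicy π) :
    IsMirrorImage φ μ (fun s a => deriv φ (π s a / μ s a)) π :=
  ⟨hπ, 0, by simp⟩

omit [Fintype S] in
theorem IsPosPolicy.isMirrorImage_zero {μ : S → A → ℝ} (hμ : IsPosPolicy μ) :
    IsMirrorImage φ μ 0 μ :=
  ⟨hμ, fun _ => deriv φ 1, fun s a => by simp [div_self (hμ.2 s a).ne']⟩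

include hφ hμ

omit [Fintype S] in
theorem exists_isMirrorImage (z : S → A → ℝ) : ∃ π, IsMirrorImage φ μ z π := by
  have := fun s => exists_simplex_dual hφ (hμ.2 s) (hμ.1.2 s) (z s)
  choose p l h1 h2 h3 using this
  exact ⟨p, ⟨⟨fun s a => (h1 s a).le, h2⟩, h1⟩, l, h3⟩

theorem IsMirrorImage.abs_deriv_sub_le {z z' π π' : S → A → ℝ} (h : IsMirrorImage φ μ z π)
    (h' : IsMirrorImage φ μ z' π') (s : S) (a : A) :
    |deriv φ (π s a / μ s a) - deriv φ (π' s a / μ s a)| ≤ 2 * ‖z - z'‖ := by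
  obtain ⟨hπ, l, hl⟩ := h
  obtain ⟨hπ', l', hl'⟩ := h'
  refine simplex_abs_deriv_sub_le hφ (hμ.2 s) (hπ.2 s) (hπ.1.2 s) (hπ'.2 s) (hπ'.1.2 s)
    (hl s) (hl' s) (fun b => ?_) a
  exact (norm_le_pi_norm ((z - z') s) b).trans (norm_le_pi_norm (z - z') s)

theorem IsMirrorImage.abs_deriv_le {z π : S → A → ℝ} (h : IsMirrorImage φ μ z π)
    (s : S) (a : A) : |deriv φ (π s a / μ s a)| ≤ |deriv φ 1| + 2 * ‖z‖ := by
  have h0 : IsMirrorImage φ μ 0 μ := hμ.isMirrorImage_zero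
  have h1 := h.abs_deriv_sub_le hφ hμ h0 s a
  rw [div_self (hμ.2 s a).ne', sub_zero] at h1
  have h2 := abs_sub_abs_le_abs_sub (deriv φ (π s a / μ s a)) (deriv φ 1)
  linarith

/-- The mirror map is Lipschitz, because the regularizer is strongly convex on the simplex. -/
theorem exists_lipschitz_mirror : ∃ C : ℝ, 0 ≤ C ∧ ∀ z z' π π' : S → A → ℝ,
    IsMirrorImage φ μ z π → IsMirrorImage φ μ z' π' → ∀ s a,
      |π s a / μ s a - π' s a / μ s a| ≤ C * ‖z - z'‖ := by
  obtain ⟨m, hm, hmon⟩ := hφ.exists_mul_abs_sub_le (∑ s, ∑ a, 1 / μ s a)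
  have hle : ∀ π : S → A → ℝ, IsPosPolicy π → ∀ s a, π s a / μ s a ≤ ∑ s, ∑ a, 1 / μ s a := by
    intro π hπ s a
    have hnn : ∀ s a, 0 ≤ 1 / μ s a := fun s a => (one_div_pos.2 (hμ.2 s a)).le
    calc π s a / μ s a ≤ 1 / μ s a :=
          div_le_div_of_nonneg_right (hπ.le_one s a) (hμ.2 s a).le
      _ ≤ ∑ a, 1 / μ s a :=
          Finset.single_le_sum (f := fun a => 1 / μ s a) (fun b _ => hnn s b) (Finset.mem_univ a)
      _ ≤ _ := Finset.single_le_sum (f := fun s => ∑ a, 1 / μ s a)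
          (fun t _ => Finset.sum_nonneg fun b _ => hnn t b) (Finset.mem_univ s)
  refine ⟨2 / m, by positivity, fun z z' π π' h h' s a => ?_⟩
  have h1 := h.abs_deriv_sub_le hφ hμ h' s a
  have h2 := hmon _ _ (div_pos (h.1.2 s a) (hμ.2 s a)) (hle π h.1 s a)
    (div_pos (h'.1.2 s a) (hμ.2 s a)) (hle π' h'.1 s a)
  rw [div_mul_eq_mul_div, le_div_iff₀ hm]
  linarith

theorem exists_lipschitz_mirror_policy : ∃ C : ℝ, 0 ≤ C ∧ ∀ z z' π π' : S → A → ℝ,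
    IsMirrorImage φ μ z π → IsMirrorImage φ μ z' π' → ∀ s a,
      |π s a - π' s a| ≤ C * ‖z - z'‖ := by
  obtain ⟨C, hC, h⟩ := exists_lipschitz_mirror hφ hμ
  refine ⟨C, hC, fun z z' π π' hz hz' s a => ?_⟩
  refine le_trans ?_ (h z z' π π' hz hz' s a)
  rw [← sub_div, abs_div, abs_of_pos (hμ.2 s a)]
  exact le_div_self (abs_nonneg _) (hμ.2 s a) (hμ.le_one s a)

theorem IsMirrorImage.unique {z π π' : S → A → ℝ} (h : IsMirrorImage φ μ z π)
    (h' : IsMirrorImage φ μ z π') : π = π' := by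
  obtain ⟨C, -, hC⟩ := exists_lipschitz_mirror_policy hφ hμ
  ext s a
  simpa [sub_eq_zero] using hC z z π π' h h' s a

end Mirror

/-! ### Value functions -/

namespace MDP

variable {S A : Type*} [Fintype S]

/-- The state-action values `r s a + γ (P^a v)_s` of a continuation value `v`. -/
def qValue (M : MDP S A) (v : S → ℝ) (s : S) (a : A) : ℝ :=
  M.r s a + M.γ * ∑ t, M.P s a t * v t

variable [Fintype A]

/-- The regularized Bellman operator of the policy `π`, of which `v_π` is the fixed point. -/
noncomputable def policyBackup (M : MDP S A) (τ : ℝ) (φ : ℝ → ℝ) (μ π : S → A → ℝ) (v : S → ℝ)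
    (s : S) : ℝ :=
  ∑ a, π s a * M.qValue v s a - τ * fDivReg φ μ π s

theorem policyMatrix_mulVec (M : MDP S A) (π : S → A → ℝ) (v : S → ℝ) (s : S) :
    (M.policyMatrix π).mulVec v s = ∑ a, π s a * ∑ t, M.P s a t * v t := by
  simp only [Matrix.mulVec, dotProduct, policyMatrix, Matrix.of_apply, Finset.sum_mul,
    Finset.mul_sum]
  rw [Finset.sum_comm]
  simp only [mul_assoc]

theorem le_policyMatrix_mulVec (M : MDP S A) {π : S → A → ℝ} (hπ : IsPolicy π) {v : S → ℝ}
    {c : ℝ} (hv : ∀ s, c ≤ v s) (s : S) : c ≤ (M.policyMatrix π).mulVec v s := by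
  rw [policyMatrix_mulVec]
  calc c = ∑ a, π s a * ∑ t, M.P s a t * c := by
        simp only [← Finset.sum_mul, M.P_sum, hπ.2, one_mul]
    _ ≤ _ := by
        gcongr with a _ t _
        · exact hπ.1 s a
        · exact M.P_nonneg s a t
        · exact hv t

/-- The minimum principle for `I - γ P_π`. -/
theorem neg_le_of_mulVec_sub_le (M : MDP S A) {π : S → A → ℝ} (hπ : IsPolicy π) {w : S → ℝ}
    {δ : ℝ} (h : ∀ s, M.γ * (M.policyMatrix π).mulVec w s - (1 - M.γ) * δ ≤ w s) (s : S) :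
    -δ ≤ w s := by
  have : Nonempty S := ⟨s⟩
  obtain ⟨b, hb⟩ := Finite.exists_min w
  have h1 := mul_le_mul_of_nonneg_left (M.le_policyMatrix_mulVec hπ hb b) M.γ_pos.le
  have h2 := h b
  have h3 : -δ ≤ w b := by nlinarith [M.γ_lt_one]
  exact h3.trans (hb s)

theorem policyBackup_eq (M : MDP S A) (τ : ℝ) (φ : ℝ → ℝ) (μ π : S → A → ℝ) (v : S → ℝ) (s : S) :
    M.policyBackup τ φ μ π v s =
      M.policyReward π s - τ * fDivReg φ μ π s + M.γ * (M.policyMatrix π).mulVec v s := by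
  rw [policyMatrix_mulVec, policyBackup, policyReward, Finset.mul_sum]
  simp only [qValue, mul_add, Finset.sum_add_distrib]
  rw [add_sub_right_comm]
  congr 1
  exact Finset.sum_congr rfl fun a _ => by ring

theorem abs_qValue_le (M : MDP S A) {v : S → ℝ} {B : ℝ} (hv : ∀ s, |v s| ≤ B) (s : S) (a : A) :
    |M.qValue v s a| ≤ (∑ s, ∑ a, |M.r s a|) + M.γ * B := by
  have h1 : |M.r s a| ≤ ∑ s, ∑ a, |M.r s a| :=
    (Finset.single_le_sum (f := fun a => |M.r s a|) (fun _ _ => abs_nonneg _)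
      (Finset.mem_univ a)).trans
    (Finset.single_le_sum (f := fun s => ∑ a, |M.r s a|)
      (fun t _ => Finset.sum_nonneg fun b _ => abs_nonneg _) (Finset.mem_univ s))
  have h2 : |∑ t, M.P s a t * v t| ≤ B := by
    calc |∑ t, M.P s a t * v t| ≤ ∑ t, |M.P s a t * v t| := Finset.abs_sum_le_sum_abs _ _
      _ ≤ ∑ t, M.P s a t * B := by
          refine Finset.sum_le_sum fun t _ => ?_
          rw [abs_mul, abs_of_nonneg (M.P_nonneg s a t)]
          exact mul_le_mul_of_nonneg_left (hv t) (M.P_nonneg s a t)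
      _ = B := by rw [← Finset.sum_mul, M.P_sum, one_mul]
  refine (abs_add_le _ _).trans (add_le_add h1 ?_)
  rw [abs_mul, abs_of_pos M.γ_pos]
  exact mul_le_mul_of_nonneg_left h2 M.γ_pos.le

omit [Fintype A] in
theorem abs_qValue_sub_le (M : MDP S A) {v v' : S → ℝ} {δ : ℝ} (hv : ∀ s, |v s - v' s| ≤ δ)
    (s : S) (a : A) : |M.qValue v s a - M.qValue v' s a| ≤ M.γ * δ := by
  rw [qValue, qValue, add_sub_add_left_eq_sub, ← mul_sub, ← Finset.sum_sub_distrib, abs_mul,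
    abs_of_pos M.γ_pos]
  refine mul_le_mul_of_nonneg_left ?_ M.γ_pos.le
  calc |∑ t, (M.P s a t * v t - M.P s a t * v' t)|
      ≤ ∑ t, |M.P s a t * v t - M.P s a t * v' t| := Finset.abs_sum_le_sum_abs _ _
    _ ≤ ∑ t, M.P s a t * δ := by
        refine Finset.sum_le_sum fun t _ => ?_
        rw [← mul_sub, abs_mul, abs_of_nonneg (M.P_nonneg s a t)]
        exact mul_le_mul_of_nonneg_left (hv t) (M.P_nonneg s a t)
    _ = δ := by rw [← Finset.sum_mul, M.P_sum, one_mul]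

variable [DecidableEq S]

/-- By the minimum principle the kernel of `I - γ P_π` is trivial. -/
theorem isUnit_det (M : MDP S A) {π : S → A → ℝ} (hπ : IsPolicy π) :
    IsUnit (1 - M.γ • M.policyMatrix π).det := by
  rw [isUnit_iff_ne_zero]
  intro h0
  obtain ⟨w, hw, h⟩ := Matrix.exists_mulVec_eq_zero_iff.2 h0
  have hfix : ∀ s, w s = M.γ * (M.policyMatrix π).mulVec w s := by
    intro s
    have := congrFun h s
    rw [Matrix.sub_mulVec, Matrix.one_mulVec, Matrix.smul_mulVec] at this
    simpa [sub_eq_zero] using this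
  refine hw (funext fun s => le_antisymm ?_ ?_)
  · have := M.neg_le_of_mulVec_sub_le hπ (w := -w) (δ := 0) (fun s => by
      rw [Matrix.mulVec_neg, Pi.neg_apply, Pi.neg_apply]
      linarith [hfix s]) s
    simpa using this
  · have := M.neg_le_of_mulVec_sub_le hπ (w := w) (δ := 0) (fun s => by
      linarith [hfix s]) s
    simpa using this

/-- The value function is the fixed point of the Bellman operator of the policy. -/
theorem policyBackup_value (M : MDP S A) (τ : ℝ) (φ : ℝ → ℝ) (μ : S → A → ℝ) {π : S → A → ℝ}
    (hπ : IsPolicy π) (s : S) :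
    M.policyBackup τ φ μ π (M.value τ φ μ π) s = M.value τ φ μ π s := by
  have h : (1 - M.γ • M.policyMatrix π).mulVec (M.value τ φ μ π) =
      M.policyReward π - τ • fDivReg φ μ π := by
    rw [value, Matrix.mulVec_mulVec, Matrix.mul_nonsing_inv _ (M.isUnit_det hπ),
      Matrix.one_mulVec]
  have h1 := congrFun h s
  rw [Matrix.sub_mulVec, Matrix.one_mulVec, Matrix.smul_mulVec] at h1
  simp only [Pi.sub_apply, Pi.smul_apply, smul_eq_mul] at h1
  rw [policyBackup_eq]
  linarith

/-- An approximate subsolution of the Bellman equation of `π` lies below `v_π`, up to the error. -/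
theorem sub_le_value (M : MDP S A) {τ : ℝ} {φ : ℝ → ℝ} {μ π : S → A → ℝ} (hπ : IsPolicy π)
    {v : S → ℝ} {δ : ℝ} (h : ∀ s, v s - (1 - M.γ) * δ ≤ M.policyBackup τ φ μ π v s) (s : S) :
    v s - δ ≤ M.value τ φ μ π s := by
  have := M.neg_le_of_mulVec_sub_le hπ (w := M.value τ φ μ π - v) (δ := δ) (fun s => by
    have h1 := M.policyBackup_value τ φ μ hπ s
    have h2 := h s
    rw [policyBackup_eq] at h1 h2
    rw [Matrix.mulVec_sub, Pi.sub_apply, Pi.sub_apply]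
    linarith) s
  rw [Pi.sub_apply] at this
  linarith

/-- An approximate supersolution of the Bellman equation of `π` lies above `v_π`, up to the error. -/
theorem value_le_add (M : MDP S A) {τ : ℝ} {φ : ℝ → ℝ} {μ π : S → A → ℝ} (hπ : IsPolicy π)
    {v : S → ℝ} {δ : ℝ} (h : ∀ s, M.policyBackup τ φ μ π v s ≤ v s + (1 - M.γ) * δ) (s : S) :
    M.value τ φ μ π s ≤ v s + δ := by
  have := M.neg_le_of_mulVec_sub_le hπ (w := v - M.value τ φ μ π) (δ := δ) (fun s => by
    have h1 := M.policyBackup_value τ φ μ hπ s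
    have h2 := h s
    rw [policyBackup_eq] at h1 h2
    rw [Matrix.mulVec_sub, Pi.sub_apply, Pi.sub_apply]
    linarith) s
  rw [Pi.sub_apply] at this
  linarith

omit [DecidableEq S] in
theorem abs_policyReward_le (M : MDP S A) {π : S → A → ℝ} (hπ : IsPolicy π) (s : S) :
    |M.policyReward π s| ≤ ∑ s, ∑ a, |M.r s a| := by
  calc |M.policyReward π s| ≤ ∑ a, |π s a * M.r s a| := Finset.abs_sum_le_sum_abs _ _
    _ ≤ ∑ a, |M.r s a| := by
        refine Finset.sum_le_sum fun a _ => ?_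
        rw [abs_mul, abs_of_nonneg (hπ.1 s a)]
        refine mul_le_of_le_one_left (abs_nonneg _) ?_
        rw [← hπ.2 s]
        exact Finset.single_le_sum (fun b _ => hπ.1 s b) (Finset.mem_univ a)
    _ ≤ _ := Finset.single_le_sum (f := fun s => ∑ a, |M.r s a|)
          (fun t _ => Finset.sum_nonneg fun b _ => abs_nonneg _) (Finset.mem_univ s)

omit [DecidableEq S] in
theorem policyMatrix_mulVec_const (M : MDP S A) {π : S → A → ℝ} (hπ : IsPolicy π) (c : ℝ) (s : S) :
    (M.policyMatrix π).mulVec (fun _ => c) s = c := by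
  rw [policyMatrix_mulVec]
  simp only [← Finset.sum_mul, M.P_sum, hπ.2, one_mul]

theorem value_le_of_fDivReg_nonneg (M : MDP S A) {τ : ℝ} (hτ : 0 < τ) {φ : ℝ → ℝ}
    {μ π : S → A → ℝ} (hπ : IsPolicy π) (hh : ∀ s, 0 ≤ fDivReg φ μ π s) (s : S) :
    M.value τ φ μ π s ≤ (∑ s, ∑ a, |M.r s a|) / (1 - M.γ) := by
  have hγ : 0 < 1 - M.γ := sub_pos.2 M.γ_lt_one
  set R := ∑ s, ∑ a, |M.r s a|
  have := M.value_le_add (τ := τ) (φ := φ) (μ := μ) hπ (v := fun _ => R / (1 - M.γ)) (δ := 0)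
    (fun s => by
      rw [policyBackup_eq, policyMatrix_mulVec_const M hπ]
      have h1 := (abs_le.1 (M.abs_policyReward_le hπ s)).2
      have h2 := mul_nonneg hτ.le (hh s)
      have h3 : R / (1 - M.γ) = R + M.γ * (R / (1 - M.γ)) := by field_simp; ring
      simp only [mul_zero, add_zero]
      linarith) s
  simpa using this

theorem abs_value_le (M : MDP S A) {τ : ℝ} (hτ : 0 < τ) {φ : ℝ → ℝ}
    {μ π : S → A → ℝ} (hπ : IsPolicy π) {H : ℝ} (hh : ∀ s, |fDivReg φ μ π s| ≤ H) (s : S) :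
    |M.value τ φ μ π s| ≤ (∑ s, ∑ a, |M.r s a| + τ * H) / (1 - M.γ) := by
  have hγ : 0 < 1 - M.γ := sub_pos.2 M.γ_lt_one
  set R := ∑ s, ∑ a, |M.r s a|
  have h3 : (R + τ * H) / (1 - M.γ) = R + τ * H + M.γ * ((R + τ * H) / (1 - M.γ)) := by
    field_simp
    ring
  rw [abs_le]
  constructor
  · have := M.sub_le_value (τ := τ) (φ := φ) (μ := μ) hπ
      (v := fun _ => -((R + τ * H) / (1 - M.γ))) (δ := 0)
      (fun s => by
        rw [policyBackup_eq, policyMatrix_mulVec_const M hπ]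
        have h1 := (abs_le.1 (M.abs_policyReward_le hπ s)).1
        have h2 := mul_le_mul_of_nonneg_left (abs_le.1 (hh s)).2 hτ.le
        simp only [mul_zero, sub_zero]
        linarith) s
    simpa using this
  · have := M.value_le_add (τ := τ) (φ := φ) (μ := μ) hπ
      (v := fun _ => (R + τ * H) / (1 - M.γ)) (δ := 0)
      (fun s => by
        rw [policyBackup_eq, policyMatrix_mulVec_const M hπ]
        have h1 := (abs_le.1 (M.abs_policyReward_le hπ s)).2
        have h2 := mul_le_mul_of_nonneg_left (abs_le.1 (hh s)).1 hτ.le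
        simp only [mul_zero, add_zero]
        linarith) s
    simpa using this

end MDP

/-! ### Monotonicity of the value function along the flow -/

section Regularizer

variable {S A : Type*} [Fintype A] {φ : ℝ → ℝ} {μ : S → A → ℝ}

theorem fDivReg_eq (hμ : IsPosPolicy μ) {π : S → A → ℝ} (hπ : IsPosPolicy π) (s : S) :
    fDivReg φ μ π s = ∑ a, μ s a * φ (π s a / μ s a) :=
  Finset.sum_congr rfl fun a _ => by
    rw [extZero, if_neg (div_pos (hπ.2 s a) (hμ.2 s a)).ne']

/-- Jensen's inequality, in the form of the tangent inequality at `1`. -/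
theorem fDivReg_nonneg (hφ : IsEntropyFunction φ) (hμ : IsPosPolicy μ) {π : S → A → ℝ}
    (hπ : IsPosPolicy π) (s : S) : 0 ≤ fDivReg φ μ π s := by
  rw [fDivReg_eq hμ hπ]
  calc (0 : ℝ) = ∑ a, (deriv φ 1 * (π s a - μ s a)) := by
        rw [← Finset.mul_sum, Finset.sum_sub_distrib, hπ.1.2, hμ.1.2]
        simp
    _ ≤ _ := by
        refine Finset.sum_le_sum fun a _ => ?_
        have h := hφ.tangent_le one_pos (div_pos (hπ.2 s a) (hμ.2 s a))
        rw [hφ.map_one, zero_add] at h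
        have h' := mul_le_mul_of_nonneg_left h (hμ.2 s a).le
        have h2 := (hμ.2 s a).ne'
        have : μ s a * (deriv φ 1 * (π s a / μ s a - 1)) = deriv φ 1 * (π s a - μ s a) := by
          field_simp
        linarith

variable [Fintype S] [DecidableEq S]

theorem MDP.value_le (M : MDP S A) {τ : ℝ} (hτ : 0 < τ) (hφ : IsEntropyFunction φ)
    (hμ : IsPosPolicy μ) {π : S → A → ℝ} (hπ : IsPosPolicy π) (s : S) :
    M.value τ φ μ π s ≤ (∑ s, ∑ a, |M.r s a|) / (1 - M.γ) :=
  M.value_le_of_fDivReg_nonneg hτ hπ.1 (fDivReg_nonneg hφ hμ hπ) s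

omit [DecidableEq S] in
theorem MDP.policyBackup_eq_sum (M : MDP S A) (τ : ℝ) (hμ : IsPosPolicy μ) {π : S → A → ℝ}
    (hπ : IsPosPolicy π) (v : S → ℝ) (s : S) :
    M.policyBackup τ φ μ π v s =
      ∑ a, (π s a * M.qValue v s a - τ * (μ s a * φ (π s a / μ s a))) := by
  rw [policyBackup, fDivReg_eq hμ hπ, Finset.sum_sub_distrib, Finset.mul_sum]

/-- The value function is continuous at positive policies. -/
theorem MDP.tendsto_value (M : MDP S A) (τ : ℝ) (hφ : IsEntropyFunction φ)
    (hμ : IsPosPolicy μ) {ι : Type*} {F : Filter ι} {π : ι → S → A → ℝ} {ρ : S → A → ℝ}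
    (hπ : ∀ᶠ i in F, IsPosPolicy (π i)) (hρ : IsPosPolicy ρ)
    (h : ∀ s a, Tendsto (fun i => π i s a) F (𝓝 (ρ s a))) (s : S) :
    Tendsto (fun i => M.value τ φ μ (π i) s) F (𝓝 (M.value τ φ μ ρ s)) := by
  set v := M.value τ φ μ ρ with hv
  have hb : ∀ s, Tendsto (fun i => M.policyBackup τ φ μ (π i) v s) F (𝓝 (v s)) := by
    intro s
    have h1 : Tendsto (fun i => ∑ a, (π i s a * M.qValue v s a -
        τ * (μ s a * φ (π i s a / μ s a)))) F (𝓝 (∑ a, (ρ s a * M.qValue v s a -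
        τ * (μ s a * φ (ρ s a / μ s a))))) := by
      refine tendsto_finsetSum _ fun a _ => ((h s a).mul_const _).sub
        ((Tendsto.const_mul _ ?_).const_mul _)
      exact (hφ.hasDerivAt (div_pos (hρ.2 s a) (hμ.2 s a))).continuousAt.tendsto.comp
        ((h s a).div_const _)
    rw [← M.policyBackup_eq_sum τ hμ hρ, hv, M.policyBackup_value τ φ μ hρ.1, ← hv] at h1
    refine h1.congr' ?_
    filter_upwards [hπ] with i hi
    rw [M.policyBackup_eq_sum τ hμ hi]
  have hγ : 0 < 1 - M.γ := sub_pos.2 M.γ_lt_one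
  rw [Metric.tendsto_nhds]
  intro ε hε
  have hev : ∀ᶠ i in F, ∀ s, dist (M.policyBackup τ φ μ (π i) v s) (v s) < (1 - M.γ) * (ε / 2) :=
    eventually_all.2 fun s => Metric.tendsto_nhds.1 (hb s) _ (by positivity)
  filter_upwards [hπ, hev] with i hi hd
  have h1 := M.sub_le_value (τ := τ) (φ := φ) (μ := μ) hi.1 (v := v) (δ := ε / 2) (fun s => by
    linarith [(abs_lt.1 (Real.dist_eq _ _ ▸ hd s)).1]) s
  have h2 := M.value_le_add (τ := τ) (φ := φ) (μ := μ) hi.1 (v := v) (δ := ε / 2) (fun s => by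
    linarith [(abs_lt.1 (Real.dist_eq _ _ ▸ hd s)).2]) s
  rw [Real.dist_eq, abs_lt]
  constructor <;> linarith

/-- Policy improvement: the value function increases along the flow in every state. The derivative
of the Bellman operator along the flow is a weighted sum of the squares of the centred advantages,
hence nonnegative, and the minimum principle for `I - γ P_π` carries this over to the values. -/
theorem MDP.value_le_value_of_flow (M : MDP S A) {τ : ℝ} (hτ : 0 < τ) (hφ : IsEntropyFunction φ)
    (hμ : IsPosPolicy μ) {π : ℝ → S → A → ℝ} {b₀ b₁ : ℝ} (hb : b₀ ≤ b₁)
    (hflow : ∀ t ∈ Icc b₀ b₁, IsPosPolicy (π t) ∧ ∃ c : S → ℝ, ∀ s a,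
      HasDerivWithinAt (fun u => π u s a) (M.flowField τ φ μ (π t) c s a) (Icc b₀ b₁) t) (s : S) :
    M.value τ φ μ (π b₀) s ≤ M.value τ φ μ (π b₁) s := by
  have hcont : ContinuousOn (fun t => M.value τ φ μ (π t) s) (Icc b₀ b₁) := by
    intro t ht
    refine M.tendsto_value τ hφ hμ ?_ (hflow t ht).1 (fun s a => ?_) s
    · filter_upwards [self_mem_nhdsWithin] with u hu using (hflow u hu).1
    · obtain ⟨c, hc⟩ := (hflow t ht).2
      exact (hc s a).continuousWithinAt
  have key : ∀ t ∈ Ico b₀ b₁, ∀ ε : ℝ, 0 < ε → ∀ᶠ u in 𝓝[>] t,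
      slope (fun t => -M.value τ φ μ (π t) s) t u < ε := by
    intro t ht ε hε
    have htI : t ∈ Icc b₀ b₁ := Ico_subset_Icc_self ht
    obtain ⟨hpos, c, hc⟩ := hflow t htI
    have hγ : 0 < 1 - M.γ := sub_pos.2 M.γ_lt_one
    set v := M.value τ φ μ (π t) with hv
    have huniq : UniqueDiffWithinAt ℝ (Icc b₀ b₁) t :=
      uniqueDiffOn_Icc (ht.1.trans_lt ht.2) t htI
    have hsum0 : ∀ s, ∑ a, M.flowField τ φ μ (π t) c s a = 0 := by
      intro s
      have h1 : HasDerivWithinAt (fun u => ∑ a, π u s a) (∑ a, M.flowField τ φ μ (π t) c s a)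
          (Icc b₀ b₁) t := HasDerivWithinAt.fun_sum fun a _ => hc s a
      have h2 : HasDerivWithinAt (fun u => ∑ a, π u s a) 0 (Icc b₀ b₁) t :=
        (hasDerivWithinAt_const t _ (1 : ℝ)).congr (fun u hu => (hflow u hu).1.1.2 s)
          (hpos.1.2 s)
      exact huniq.eq_deriv _ h1 h2
    have hderiv : ∀ s, HasDerivWithinAt (fun u => M.policyBackup τ φ μ (π u) v s)
        (∑ a, M.flowField τ φ μ (π t) c s a *
          (M.qValue v s a - τ * deriv φ (π t s a / μ s a))) (Icc b₀ b₁) t := by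
      intro s
      have h1 : HasDerivWithinAt (fun u => ∑ a, (π u s a * M.qValue v s a -
          τ * (μ s a * φ (π u s a / μ s a)))) (∑ a, M.flowField τ φ μ (π t) c s a *
          (M.qValue v s a - τ * deriv φ (π t s a / μ s a))) (Icc b₀ b₁) t := by
        refine HasDerivWithinAt.fun_sum fun a _ => ?_
        have h2 := (hφ.hasDerivAt (div_pos (hpos.2 s a) (hμ.2 s a))).comp_hasDerivWithinAt t
          ((hc s a).div_const (μ s a))
        refine (((hc s a).mul_const (M.qValue v s a)).sub
          ((h2.const_mul (μ s a)).const_mul τ)).congr_deriv ?_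
        have := (hμ.2 s a).ne'
        field_simp
      exact h1.congr (fun u hu => M.policyBackup_eq_sum τ hμ (hflow u hu).1 v s)
        (M.policyBackup_eq_sum τ hμ hpos v s)
    have hnn : ∀ s, 0 ≤ ∑ a, M.flowField τ φ μ (π t) c s a *
        (M.qValue v s a - τ * deriv φ (π t s a / μ s a)) := by
      intro s
      -- as the components of the field add up to zero, the constant `v s - c s` may be subtracted
      have h1 : ∑ a, M.flowField τ φ μ (π t) c s a *
          (M.qValue v s a - τ * deriv φ (π t s a / μ s a)) =
          ∑ a, M.flowField τ φ μ (π t) c s a *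
          (M.qValue v s a - τ * deriv φ (π t s a / μ s a) - (v s - c s)) := by
        simp only [mul_sub _ _ (v s - c s), Finset.sum_sub_distrib]
        rw [← Finset.sum_mul, hsum0 s, zero_mul, sub_zero]
      rw [h1]
      refine Finset.sum_nonneg fun a _ => ?_
      have h2 : M.flowField τ φ μ (π t) c s a *
          (M.qValue v s a - τ * deriv φ (π t s a / μ s a) - (v s - c s)) =
          μ s a * (deriv (deriv φ) (π t s a / μ s a))⁻¹ / τ *
          (M.qValue v s a - τ * deriv φ (π t s a / μ s a) - (v s - c s)) ^ 2 := by
        rw [flowField, qValue, ← hv]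
        ring
      rw [h2]
      have h3 := hφ.deriv_deriv_pos (div_pos (hpos.2 s a) (hμ.2 s a))
      have h4 := hμ.2 s a
      positivity
    have hslope : ∀ s, ∀ᶠ u in 𝓝[>] t,
        -((1 - M.γ) * (ε / 2)) < slope (fun u => M.policyBackup τ φ μ (π u) v s) t u := by
      intro s
      have h1 : HasDerivWithinAt (fun u => M.policyBackup τ φ μ (π u) v s)
        (∑ a, M.flowField τ φ μ (π t) c s a *
          (M.qValue v s a - τ * deriv φ (π t s a / μ s a))) (Ioi t) t :=
        (hderiv s).mono_of_mem_nhdsWithin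
          (mem_of_superset (Ioo_mem_nhdsGT ht.2) fun u hu => ⟨ht.1.trans hu.1.le, hu.2.le⟩)
      have h2 := hasDerivWithinAt_iff_tendsto_slope' (by simp) |>.1 h1
      refine h2.eventually (lt_mem_nhds (lt_of_lt_of_le ?_ (hnn s)))
      have : 0 < (1 - M.γ) * (ε / 2) := by positivity
      linarith
    filter_upwards [eventually_all.2 hslope, Ioo_mem_nhdsGT ht.2] with u hu hut
    have hut0 : 0 < u - t := sub_pos.2 hut.1
    have h1 := M.sub_le_value (τ := τ) (φ := φ) (μ := μ)
      (hflow u ⟨ht.1.trans hut.1.le, hut.2.le⟩).1.1 (v := v) (δ := ε / 2 * (u - t)) (fun s => by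
        have h2 := hu s
        rw [slope_def_field, lt_div_iff₀ hut0, hv, M.policyBackup_value τ φ μ hpos.1, ← hv] at h2
        linarith) s
    rw [slope_def_field, div_lt_iff₀ hut0]
    have : 0 < ε / 2 * (u - t) := by positivity
    linarith
  have := image_le_of_liminf_slope_right_le_deriv_boundary
    (f := fun t => -M.value τ φ μ (π t) s) (a := b₀) (b := b₁)
    (B := fun _ => -M.value τ φ μ (π b₀) s) (B' := fun _ => 0) hcont.neg le_rfl
    continuousOn_const (fun x _ => hasDerivWithinAt_const _ _ _)
    (fun t ht r hr => (key t ht r hr).frequently) (right_mem_Icc.2 hb)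
  simpa using this

end Regularizer

/-! ### Optimality of greedy policies -/

section Optimality

variable {S A : Type*} [Fintype S] [Fintype A] {φ : ℝ → ℝ} (hφ : IsEntropyFunction φ)
  {μ : S → A → ℝ} (hμ : IsPosPolicy μ) (M : MDP S A) {τ : ℝ} (hτ : 0 < τ)

theorem IsPosPolicy.isAdmissible {S A : Type*} [Fintype A] {φ : ℝ → ℝ} {π : S → A → ℝ}
    (hπ : IsPosPolicy π) : IsAdmissible φ π :=
  ⟨hπ.1, fun s a h => absurd h (hπ.2 s a).ne'⟩

include hφ hμ hτ

/-- The mirror image of `q / τ`, with `q` the state-action values of `v`, maximizes the regularized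
Bellman operator at `v`; each summand of the gap is the distance of the convex function `φ` from
its tangent. -/
theorem MDP.policyBackup_le_greedy {v : S → ℝ} {ρ π : S → A → ℝ}
    (hρ : IsMirrorImage φ μ (fun s a => M.qValue v s a / τ) ρ) (hπ : IsAdmissible φ π) (s : S) :
    M.policyBackup τ φ μ π v s ≤ M.policyBackup τ φ μ ρ v s ∧
      (M.policyBackup τ φ μ π v s = M.policyBackup τ φ μ ρ v s → π s = ρ s) := by
  obtain ⟨hρp, l, hl⟩ := hρ
  set x : A → ℝ := fun a => ρ s a / μ s a with hx
  have hxpos : ∀ a, 0 < x a := fun a => div_pos (hρp.2 s a) (hμ.2 s a)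
  have hgap : M.policyBackup τ φ μ ρ v s - M.policyBackup τ φ μ π v s =
      ∑ a, τ * μ s a * (extZero φ (π s a / μ s a) -
        (φ (x a) + deriv φ (x a) * (π s a / μ s a - x a))) := by
    have h1 : ∑ a, τ * l s * (ρ s a - π s a) = 0 := by
      rw [← Finset.mul_sum, Finset.sum_sub_distrib, hπ.1.2, hρp.1.2, sub_self, mul_zero]
    rw [M.policyBackup_eq_sum τ hμ hρp, policyBackup, fDivReg, Finset.mul_sum,
      ← Finset.sum_sub_distrib, ← Finset.sum_sub_distrib, ← add_zero (∑ a, (_ - _)), ← h1,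
      ← Finset.sum_add_distrib]
    refine Finset.sum_congr rfl fun a _ => ?_
    have h2 := hl s a
    have h3 := (hμ.2 s a).ne'
    simp only [hx]
    have h4 : M.qValue v s a = τ * (deriv φ (ρ s a / μ s a) - l s) := by
      rw [h2]
      field_simp
      ring
    rw [h4]
    field_simp
    ring
  have hxπ : ∀ a, 0 ≤ π s a / μ s a := fun a => div_nonneg (hπ.1.1 s a) (hμ.2 s a).le
  have hx0 : ∀ a, π s a / μ s a = 0 → FiniteAtZero φ := fun a h =>
    hπ.2 s a ((div_eq_zero_iff.1 h).resolve_right (hμ.2 s a).ne')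
  have hterm : ∀ a ∈ Finset.univ, 0 ≤ τ * μ s a * (extZero φ (π s a / μ s a) -
        (φ (x a) + deriv φ (x a) * (π s a / μ s a - x a))) := fun a _ =>
    mul_nonneg (mul_pos hτ (hμ.2 s a)).le
      (sub_nonneg.2 (hφ.tangent_le_extZero (hxpos a) (hxπ a) (hx0 a)))
  refine ⟨sub_nonneg.1 (hgap ▸ Finset.sum_nonneg hterm), fun heq => funext fun a => ?_⟩
  rw [heq, sub_self] at hgap
  have h0 := (Finset.sum_eq_zero_iff_of_nonneg hterm).1 hgap.symm a (Finset.mem_univ a)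
  by_contra hne
  have hne' : x a ≠ π s a / μ s a := fun h =>
    hne ((div_left_inj' (hμ.2 s a).ne').1 h).symm
  exact (mul_pos (mul_pos hτ (hμ.2 s a)) (sub_pos.2
    (hφ.tangent_lt_extZero (hxpos a) (hxπ a) (hx0 a) hne'))).ne' h0

variable [DecidableEq S]

theorem MDP.isOptimal_of_greedy {ρ : S → A → ℝ}
    (hρ : IsMirrorImage φ μ (fun s a => M.qValue (M.value τ φ μ ρ) s a / τ) ρ) :
    M.IsOptimal τ φ μ ρ := by
  refine ⟨hρ.1.isAdmissible, fun π hπ s => ?_⟩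
  have := M.value_le_add (τ := τ) (φ := φ) (μ := μ) hπ.1 (v := M.value τ φ μ ρ) (δ := 0)
    (fun s => by
      have h := (M.policyBackup_le_greedy hφ hμ hτ hρ hπ s).1
      rw [M.policyBackup_value τ φ μ hρ.1.1] at h
      linarith) s
  linarith

theorem MDP.IsOptimal.eq_of_greedy {ρ π : S → A → ℝ}
    (hρ : IsMirrorImage φ μ (fun s a => M.qValue (M.value τ φ μ ρ) s a / τ) ρ)
    (hπ : M.IsOptimal τ φ μ π) : π = ρ := by
  have hval : M.value τ φ μ π = M.value τ φ μ ρ := funext fun s =>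
    le_antisymm ((M.isOptimal_of_greedy hφ hμ hτ hρ).2 π hπ.1 s) (hπ.2 ρ hρ.1.isAdmissible s)
  funext s
  refine (M.policyBackup_le_greedy hφ hμ hτ hρ hπ.1 s).2 ?_
  rw [M.policyBackup_value τ φ μ hρ.1.1, ← hval, M.policyBackup_value τ φ μ hπ.1.1]

end Optimality

/-! ### The equation `u' = -u + f` -/

section LinearRelaxation

/-- Comparison principle for the scalar equation `u' = -u + f`. -/
theorem sub_le_exp_mul_of_hasDerivWithinAt {u f : ℝ → ℝ} {b₀ b₁ F : ℝ} (hb : b₀ ≤ b₁)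
    (hu : ∀ t ∈ Icc b₀ b₁, HasDerivWithinAt u (-u t + f t) (Icc b₀ b₁) t)
    (hf : ∀ t ∈ Icc b₀ b₁, f t ≤ F) :
    u b₁ - F ≤ Real.exp (b₀ - b₁) * (u b₀ - F) := by
  have hd : ∀ t ∈ Icc b₀ b₁, HasDerivWithinAt (fun t => Real.exp t * (u t - F))
      (Real.exp t * (f t - F)) (Icc b₀ b₁) t := by
    intro t ht
    refine ((Real.hasDerivAt_exp t).hasDerivWithinAt.mul ((hu t ht).sub_const F)).congr_deriv ?_
    ring
  have hanti : AntitoneOn (fun t => Real.exp t * (u t - F)) (Icc b₀ b₁) := by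
    refine antitoneOn_of_hasDerivWithinAt_nonpos (f' := fun t => Real.exp t * (f t - F))
      (convex_Icc _ _) (fun t ht => (hd t ht).continuousWithinAt)
      (fun t ht => (hd t (interior_subset ht)).mono interior_subset) fun t ht => ?_
    exact mul_nonpos_of_nonneg_of_nonpos (Real.exp_pos t).le
      (sub_nonpos.2 (hf t (interior_subset ht)))
  have h := hanti (left_mem_Icc.2 hb) (right_mem_Icc.2 hb) hb
  simp only at h
  rw [Real.exp_sub, div_mul_eq_mul_div, le_div_iff₀ (Real.exp_pos _)]
  linarith

theorem abs_le_of_hasDerivWithinAt {u f : ℝ → ℝ} {b₀ b₁ F : ℝ} (hb : b₀ ≤ b₁)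
    (hu : ∀ t ∈ Icc b₀ b₁, HasDerivWithinAt u (-u t + f t) (Icc b₀ b₁) t)
    (hf : ∀ t ∈ Icc b₀ b₁, |f t| ≤ F) (h0 : |u b₀| ≤ F) : |u b₁| ≤ F := by
  have h1 := sub_le_exp_mul_of_hasDerivWithinAt hb hu fun t ht => (abs_le.1 (hf t ht)).2
  have h2 := sub_le_exp_mul_of_hasDerivWithinAt (u := fun t => -u t) (f := fun t => -f t) hb
    (fun t ht => (hu t ht).neg.congr_deriv (by ring))
    (F := F) (fun t ht => by linarith [(abs_le.1 (hf t ht)).1])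
  have he := Real.exp_pos (b₀ - b₁)
  have h3 := abs_le.1 h0
  rw [abs_le]
  constructor
  · nlinarith [mul_nonpos_of_nonneg_of_nonpos he.le (show -u b₀ - F ≤ 0 by linarith)]
  · nlinarith [mul_nonpos_of_nonneg_of_nonpos he.le (show u b₀ - F ≤ 0 by linarith)]

theorem eventually_le_add_of_hasDerivWithinAt {u f : ℝ → ℝ} {ℓ ε : ℝ} (hε : 0 < ε)
    (hu : ∀ t : ℝ, 0 ≤ t → HasDerivWithinAt u (-u t + f t) (Ici 0) t)
    (hf : Tendsto f atTop (𝓝 ℓ)) : ∀ᶠ t in atTop, u t < ℓ + ε := by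
  obtain ⟨T, hT⟩ := eventually_atTop.1 (hf.eventually (gt_mem_nhds (show ℓ < ℓ + ε / 2 by linarith)))
  set b := max T 0 with hb
  have hlim : Tendsto (fun t => Real.exp (b - t) * (u b - (ℓ + ε / 2))) atTop (𝓝 0) := by
    have h1 : Tendsto (fun t : ℝ => b - t) atTop atBot :=
      tendsto_atBot_add_const_left _ b tendsto_neg_atTop_atBot
    simpa using (Real.tendsto_exp_atBot.comp h1).mul_const (u b - (ℓ + ε / 2))
  filter_upwards [hlim.eventually (gt_mem_nhds (half_pos hε)), eventually_ge_atTop b] with t ht hbt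
  have h := sub_le_exp_mul_of_hasDerivWithinAt (F := ℓ + ε / 2) hbt
    (fun r hr => (hu r ((le_max_right T 0).trans hr.1)).mono
      fun q hq => (le_max_right T 0).trans hq.1)
    (fun r hr => (hT r ((le_max_left T 0).trans hr.1)).le)
  linarith

theorem tendsto_of_hasDerivWithinAt_neg_add {u f : ℝ → ℝ} {ℓ : ℝ}
    (hu : ∀ t : ℝ, 0 ≤ t → HasDerivWithinAt u (-u t + f t) (Ici 0) t)
    (hf : Tendsto f atTop (𝓝 ℓ)) : Tendsto u atTop (𝓝 ℓ) := by
  rw [Metric.tendsto_nhds]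
  intro ε hε
  filter_upwards [eventually_le_add_of_hasDerivWithinAt hε hu hf,
    eventually_le_add_of_hasDerivWithinAt (u := fun t => -u t) (f := fun t => -f t) hε
      (fun t ht => (hu t ht).neg.congr_deriv (by ring)) hf.neg] with t h1 h2
  rw [Real.dist_eq, abs_lt]
  constructor <;> linarith

end LinearRelaxation

/-! ### Convergence of the flow -/

section Convergence

variable {S A : Type*} [Fintype S] [DecidableEq S] [Fintype A] {φ : ℝ → ℝ}
  (hφ : IsEntropyFunction φ) {μ : S → A → ℝ} (hμ : IsPosPolicy μ) (M : MDP S A) {τ : ℝ}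
  (hτ : 0 < τ)
include hφ hμ hτ

omit hτ [DecidableEq S] in
theorem tendsto_of_isMirrorImage {ι : Type*} {F : Filter ι} {z π : ι → S → A → ℝ}
    {ζ ρ : S → A → ℝ} (h : ∀ᶠ i in F, IsMirrorImage φ μ (z i) (π i)) (hρ : IsMirrorImage φ μ ζ ρ)
    (hz : Tendsto z F (𝓝 ζ)) : Tendsto π F (𝓝 ρ) := by
  obtain ⟨C, -, hC⟩ := exists_lipschitz_mirror_policy hφ hμ
  refine tendsto_pi_nhds.2 fun s => tendsto_pi_nhds.2 fun a => ?_
  rw [tendsto_iff_dist_tendsto_zero]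
  have h1 : Tendsto (fun i => C * ‖z i - ζ‖) F (𝓝 0) := by
    simpa using (tendsto_iff_norm_sub_tendsto_zero.1 hz).const_mul C
  refine squeeze_zero' (Eventually.of_forall fun _ => dist_nonneg) ?_ h1
  filter_upwards [h] with i hi using hC _ _ _ _ hi hρ s a

/-- Along the flow the dual variable `φ'(π / μ)` relaxes towards `q / τ`, up to a term `k s` that does
not depend on the action. -/
theorem MDP.IsQuasiNewtonFlow.hasDerivWithinAt_dual {π : ℝ → S → A → ℝ}
    (h : M.IsQuasiNewtonFlow τ φ μ π) {t : ℝ} (ht : 0 ≤ t) : ∃ k : S → ℝ, ∀ s a,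
      HasDerivWithinAt (fun u => deriv φ (π u s a / μ s a))
        (-deriv φ (π t s a / μ s a) + M.qValue (M.value τ φ μ (π t)) s a / τ + k s) (Ici 0) t := by
  obtain ⟨hpos, c, hc⟩ := h t ht
  refine ⟨fun s => (c s - M.value τ φ μ (π t) s) / τ, fun s a => ?_⟩
  have hx := div_pos (hpos.2 s a) (hμ.2 s a)
  refine ((hφ.hasDerivAt_deriv hx).comp_hasDerivWithinAt t
    ((hc s a).div_const (μ s a))).congr_deriv ?_
  have h1 := (hφ.deriv_deriv_pos hx).ne'
  have h2 := (hμ.2 s a).ne'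
  rw [flowField, qValue]
  field_simp
  ring

/-- A solution of the flow converges to a policy that is greedy for its own value function. -/
theorem MDP.IsQuasiNewtonFlow.exists_tendsto_greedy {π : ℝ → S → A → ℝ}
    (h : M.IsQuasiNewtonFlow τ φ μ π) : ∃ ρ : S → A → ℝ,
      IsMirrorImage φ μ (fun s a => M.qValue (M.value τ φ μ ρ) s a / τ) ρ ∧
        Tendsto π atTop (𝓝 ρ) := by
  have hv : ∀ s, ∃ v, Tendsto (fun t => M.value τ φ μ (π t) s) atTop (𝓝 v) := by
    intro s
    have hmono : Monotone (fun t => M.value τ φ μ (π (max t 0)) s) := by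
      intro t₁ t₂ ht
      refine M.value_le_value_of_flow hτ hφ hμ (max_le_max_right 0 ht) (fun t ht' => ?_) s
      have ht0 : 0 ≤ t := (le_max_right t₁ 0).trans ht'.1
      obtain ⟨hp, c, hc⟩ := h t ht0
      exact ⟨hp, c, fun s a => (hc s a).mono fun q hq => (le_max_right t₁ 0).trans hq.1⟩
    have hbdd : BddAbove (range fun t => M.value τ φ μ (π (max t 0)) s) := by
      refine ⟨_, forall_mem_range.2 fun t => M.value_le hτ hφ hμ (h _ (le_max_right t 0)).1 s⟩
    refine ⟨_, (tendsto_atTop_ciSup hmono hbdd).congr' ?_⟩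
    filter_upwards [eventually_ge_atTop 0] with t ht
    rw [max_eq_left ht]
  choose v hv using hv
  have hq : ∀ s a, Tendsto (fun t => M.qValue (M.value τ φ μ (π t)) s a / τ) atTop
      (𝓝 (M.qValue v s a / τ)) := fun s a =>
    (((tendsto_finsetSum _ fun t _ => (hv t).const_mul (M.P s a t)).const_mul M.γ).const_add
      (M.r s a)).div_const τ
  -- centring the dual variables removes the unknown multipliers from their equation
  set z : ℝ → S → A → ℝ := fun t s a =>
    deriv φ (π t s a / μ s a) - ∑ b, μ s b * deriv φ (π t s b / μ s b) with hz
  set ζ : S → A → ℝ := fun s a =>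
    M.qValue v s a / τ - ∑ b, μ s b * (M.qValue v s b / τ) with hζ
  have hzlim : Tendsto z atTop (𝓝 ζ) := by
    refine tendsto_pi_nhds.2 fun s => tendsto_pi_nhds.2 fun a => ?_
    refine tendsto_of_hasDerivWithinAt_neg_add
      (f := fun t => M.qValue (M.value τ φ μ (π t)) s a / τ -
        ∑ b, μ s b * (M.qValue (M.value τ φ μ (π t)) s b / τ)) (fun t ht => ?_)
      ((hq s a).sub (tendsto_finsetSum _ fun b _ => (hq s b).const_mul (μ s b)))
    obtain ⟨k, hk⟩ := h.hasDerivWithinAt_dual hφ hμ M hτ ht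
    refine ((hk s a).sub (HasDerivWithinAt.fun_sum (u := Finset.univ)
      fun b _ => (hk s b).const_mul (μ s b))).congr_deriv ?_
    simp only [hz, mul_add, Finset.sum_add_distrib, ← Finset.sum_mul, hμ.1.2, mul_neg,
      Finset.sum_neg_distrib]
    ring
  obtain ⟨ρ, hρ, l, hl⟩ := exists_isMirrorImage hφ hμ (fun s a => M.qValue v s a / τ)
  have hρζ : IsMirrorImage φ μ ζ ρ :=
    ⟨hρ, fun s => l s + ∑ b, μ s b * (M.qValue v s b / τ), fun s a => by
      rw [hl, hζ]
      ring⟩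
  have hlim : Tendsto π atTop (𝓝 ρ) := by
    refine tendsto_of_isMirrorImage hφ hμ ?_ hρζ hzlim
    filter_upwards [eventually_ge_atTop 0] with t ht
    exact ⟨(h t ht).1, fun s => ∑ b, μ s b * deriv φ (π t s b / μ s b), fun s a => by simp [hz]⟩
  have hval : M.value τ φ μ ρ = v := by
    funext s
    refine tendsto_nhds_unique (M.tendsto_value τ hφ hμ ?_ hρ (fun s a => ?_) s) (hv s)
    · filter_upwards [eventually_ge_atTop 0] with t ht using (h t ht).1
    · exact tendsto_pi_nhds.1 (tendsto_pi_nhds.1 hlim s) a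
  exact ⟨ρ, by rw [hval]; exact ⟨hρ, l, hl⟩, hlim⟩

end Convergence

/-! ### Global existence for bounded Lipschitz vector fields -/

section GlobalExistence

variable {E : Type*} [NormedAddCommGroup E] [NormedSpace ℝ E] [CompleteSpace E]

open scoped NNReal in
/-- A bounded Lipschitz vector field has a forward solution for all times. -/
theorem exists_forward_solution {G : E → E} {L B : ℝ≥0} (hL : LipschitzWith L G)
    (hB : ∀ x, ‖G x‖ ≤ B) (x₀ : E) : ∃ z : ℝ → E, z 0 = x₀ ∧
      ∀ t : ℝ, 0 ≤ t → HasDerivWithinAt z (G (z t)) (Ici 0) t := by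
  have hloc : ∀ n : ℕ, ∃ α : ℝ → E, α 0 = x₀ ∧
      ∀ t ∈ Icc (0 : ℝ) n, HasDerivWithinAt α (G (α t)) (Icc 0 n) t := by
    intro n
    have hP : IsPicardLindelof (fun _ : ℝ => G) (tmin := 0) (tmax := n)
        ⟨0, left_mem_Icc.2 n.cast_nonneg⟩ x₀ (B * n) 0 B L :=
      IsPicardLindelof.of_time_independent (fun x _ => hB x) hL.lipschitzOnWith (by simp)
    exact hP.exists_eq_forall_mem_Icc_hasDerivWithinAt₀
  choose α hα0 hα using hloc
  have huniq : ∀ n m : ℕ, n ≤ m → EqOn (α n) (α m) (Icc 0 n) := by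
    intro n m hnm
    have hsub : Icc (0 : ℝ) n ⊆ Icc 0 m := Icc_subset_Icc_right (by exact_mod_cast hnm)
    have hright : ∀ (k : ℕ), ∀ t ∈ Ico (0 : ℝ) k, HasDerivWithinAt (α k) (G (α k t)) (Ici t) t :=
      fun k t ht => (hα k t (Ico_subset_Icc_self ht)).mono_of_mem_nhdsWithin
        (mem_of_superset (Icc_mem_nhdsGE ht.2) (Icc_subset_Icc_left ht.1))
    refine ODE_solution_unique (v := fun _ => G) (fun _ => hL)
      (fun t ht => (hα n t ht).continuousWithinAt) (hright n)
      (fun t ht => ((hα m t (hsub ht)).mono hsub).continuousWithinAt)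
      (fun t ht => hright m t ⟨ht.1, ht.2.trans_le (by exact_mod_cast hnm)⟩) ?_
    rw [hα0, hα0]
  refine ⟨fun t => α (⌈t⌉₊ + 1) t, hα0 _, fun t ht => ?_⟩
  set n := ⌈t⌉₊ + 1 with hn
  have htn : t < n := by
    rw [hn]
    push_cast
    linarith [Nat.le_ceil t]
  have heq : ∀ u ∈ Icc (0 : ℝ) n, α (⌈u⌉₊ + 1) u = α n u := by
    intro u hu
    rcases le_total (⌈u⌉₊ + 1) n with h | h
    · refine huniq _ _ h ⟨hu.1, ?_⟩
      push_cast
      linarith [Nat.le_ceil u]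
    · exact (huniq _ _ h hu).symm
  have hmem : Icc (0 : ℝ) n ∈ 𝓝[Ici 0] t := by
    rw [← Ici_inter_Iic]
    exact inter_mem_nhdsWithin _ (Iic_mem_nhds htn)
  exact ((hα n t ⟨ht, htn.le⟩).congr heq (heq t ⟨ht, htn.le⟩)).mono_of_mem_nhdsWithin hmem

end GlobalExistence

/-! ### The flow in dual variables -/

section Existence

variable {S A : Type*} [Fintype S] [DecidableEq S] [Fintype A] {φ : ℝ → ℝ}
  (hφ : IsEntropyFunction φ) {μ : S → A → ℝ} (hμ : IsPosPolicy μ) (M : MDP S A) {τ : ℝ}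
  (hτ : 0 < τ)
include hφ hμ hτ

/-- If the dual variable relaxes towards `q / τ`, its mirror image solves the flow. -/
theorem exists_hasDerivWithinAt_flowField {D : Set ℝ} {t : ℝ} (ht : t ∈ D)
    {z π : ℝ → S → A → ℝ} (h : ∀ u ∈ D, IsMirrorImage φ μ (z u) (π u))
    (hz : ∀ s a, HasDerivWithinAt (fun u => z u s a)
      (-z t s a + M.qValue (M.value τ φ μ (π t)) s a / τ) D t) :
    ∃ c : S → ℝ, ∀ s a,
      HasDerivWithinAt (fun u => π u s a) (M.flowField τ φ μ (π t) c s a) D t := by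
  have hzc : ContinuousWithinAt z D t :=
    continuousWithinAt_pi.2 fun s => continuousWithinAt_pi.2 fun a => (hz s a).continuousWithinAt
  have hπc : ContinuousWithinAt π D t :=
    tendsto_of_isMirrorImage hφ hμ (by
      filter_upwards [self_mem_nhdsWithin] with u hu using h u hu) (h t ht) hzc
  choose! l hl using fun u hu => (h u hu).2
  have hk := fun s => exists_hasDerivWithinAt_simplex_dual hφ (hμ.2 s) ht
    (z := fun u => z u s) (p := fun u => π u s) (l := fun u => l u s)
    (fun u hu => (h u hu).1.2 s) (fun u hu => (h u hu).1.1.2 s) (fun u hu => hl u hu s) (hz s)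
    (fun a => continuousWithinAt_pi.1 (continuousWithinAt_pi.1 hπc s) a)
  choose k hk using hk
  refine ⟨fun s => M.value τ φ μ (π t) s + τ * (k s + l t s), fun s a =>
    (hk s a).congr_deriv ?_⟩
  have h1 := hl t ht s a
  rw [MDP.flowField, MDP.qValue, h1]
  field_simp
  ring

/-- On bounded sets of dual variables the value function of the mirror image is bounded and
Lipschitz: a bound on `z` is a bound on `φ'(π / μ)`, which in turn is a Lipschitz constant for `φ` at
the ratios `π / μ`, even if `φ` is unbounded near `0`. -/
theorem exists_bound_value_mirror {K : ℝ} (hK : 0 ≤ K) : ∃ B L : ℝ, 0 ≤ B ∧ 0 ≤ L ∧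
    ∀ z z' π π' : S → A → ℝ, IsMirrorImage φ μ z π → IsMirrorImage φ μ z' π' → ‖z‖ ≤ K → ‖z'‖ ≤ K →
      ∀ s, |M.value τ φ μ π s| ≤ B ∧
        |M.value τ φ μ π s - M.value τ φ μ π' s| ≤ L * ‖z - z'‖ := by
  obtain ⟨C, hC, hCx⟩ := exists_lipschitz_mirror hφ hμ
  have hγ : 0 < 1 - M.γ := sub_pos.2 M.γ_lt_one
  have hγ0 := M.γ_pos
  set R := ∑ s, ∑ a, |M.r s a|
  have hR : 0 ≤ R := Finset.sum_nonneg fun _ _ => Finset.sum_nonneg fun _ _ => abs_nonneg _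
  set Y := |deriv φ 1| + 2 * K with hYdef
  have hY : 0 ≤ Y := by positivity
  set B := (R + τ * (Y * (C * K))) / (1 - M.γ) with hBdef
  have hB : 0 ≤ B := by positivity
  set Λ := (Fintype.card A : ℝ) * (C * (R + M.γ * B) + τ * (Y * C)) with hΛ
  have hΛ0 : 0 ≤ Λ := by positivity
  have hφlip : ∀ z z' π π' : S → A → ℝ, IsMirrorImage φ μ z π → IsMirrorImage φ μ z' π' →
      ‖z‖ ≤ K → ‖z'‖ ≤ K → ∀ s a, |φ (π s a / μ s a) - φ (π' s a / μ s a)| ≤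
        Y * (C * ‖z - z'‖) := by
    intro z z' π π' h h' hz hz' s a
    refine (hφ.abs_sub_le (Y := Y) (div_pos (h.1.2 s a) (hμ.2 s a))
      (div_pos (h'.1.2 s a) (hμ.2 s a)) ?_ ?_).trans
      (mul_le_mul_of_nonneg_left (hCx z z' π π' h h' s a) hY)
    · exact (h.abs_deriv_le hφ hμ s a).trans (by linarith)
    · exact (h'.abs_deriv_le hφ hμ s a).trans (by linarith)
  have hval : ∀ z π : S → A → ℝ, IsMirrorImage φ μ z π → ‖z‖ ≤ K →
      ∀ s, |M.value τ φ μ π s| ≤ B := by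
    intro z π h hz
    refine M.abs_value_le hτ h.1.1 fun s => ?_
    have h0 : IsMirrorImage φ μ 0 μ := hμ.isMirrorImage_zero
    rw [fDivReg_eq hμ h.1]
    calc |∑ a, μ s a * φ (π s a / μ s a)| ≤ ∑ a, |μ s a * φ (π s a / μ s a)| :=
          Finset.abs_sum_le_sum_abs _ _
      _ ≤ ∑ a, μ s a * (Y * (C * K)) := by
          refine Finset.sum_le_sum fun a _ => ?_
          rw [abs_mul, abs_of_pos (hμ.2 s a)]
          refine mul_le_mul_of_nonneg_left ?_ (hμ.2 s a).le
          have h1 := hφlip z 0 π μ h h0 hz (by simpa using hK) s a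
          rw [div_self (hμ.2 s a).ne', hφ.map_one, sub_zero, sub_zero] at h1
          exact h1.trans (by gcongr)
      _ = Y * (C * K) := by rw [← Finset.sum_mul, hμ.1.2, one_mul]
  have hback : ∀ z z' π π' : S → A → ℝ, IsMirrorImage φ μ z π → IsMirrorImage φ μ z' π' →
      ‖z‖ ≤ K → ‖z'‖ ≤ K → ∀ s, |M.policyBackup τ φ μ π' (M.value τ φ μ π) s -
        M.value τ φ μ π s| ≤ Λ * ‖z - z'‖ := by
    intro z z' π π' h h' hz hz' s
    set v := M.value τ φ μ π with hv
    have hvB : ∀ s, |v s| ≤ B := hval z π h hz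
    have hq : ∀ a, |M.qValue v s a| ≤ R + M.γ * B := M.abs_qValue_le hvB s
    have h3 : M.policyBackup τ φ μ π' v s - v s = ∑ a, ((π' s a - π s a) * M.qValue v s a -
        τ * (μ s a * (φ (π' s a / μ s a) - φ (π s a / μ s a)))) := by
      have h4 : v s = M.policyBackup τ φ μ π v s := (M.policyBackup_value τ φ μ h.1.1 s).symm
      rw [h4, M.policyBackup_eq_sum τ hμ h.1, M.policyBackup_eq_sum τ hμ h'.1,
        ← Finset.sum_sub_distrib]
      exact Finset.sum_congr rfl fun a _ => by ring
    rw [h3]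
    calc _ ≤ ∑ a, |(π' s a - π s a) * M.qValue v s a -
          τ * (μ s a * (φ (π' s a / μ s a) - φ (π s a / μ s a)))| := Finset.abs_sum_le_sum_abs _ _
      _ ≤ ∑ _a : A, (C * (R + M.γ * B) + τ * (Y * C)) * ‖z - z'‖ := by
          refine Finset.sum_le_sum fun a _ => ?_
          have h5 : |π' s a - π s a| ≤ C * ‖z - z'‖ := by
            rw [norm_sub_rev]
            refine le_trans ?_ (hCx z' z π' π h' h s a)
            rw [← sub_div, abs_div, abs_of_pos (hμ.2 s a)]
            exact le_div_self (abs_nonneg _) (hμ.2 s a) (hμ.le_one s a)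
          have h6 := hφlip z' z π' π h' h hz' hz s a
          rw [norm_sub_rev] at h6
          refine (abs_sub _ _).trans ?_
          rw [abs_mul, abs_mul, abs_mul, abs_of_pos hτ, abs_of_pos (hμ.2 s a)]
          have h7 : μ s a * |φ (π' s a / μ s a) - φ (π s a / μ s a)| ≤ Y * (C * ‖z - z'‖) :=
            (mul_le_of_le_one_left (abs_nonneg _) (hμ.le_one s a)).trans h6
          calc _ ≤ C * ‖z - z'‖ * (R + M.γ * B) + τ * (Y * (C * ‖z - z'‖)) := by
                gcongr
                exact hq a
            _ = _ := by ring
      _ = Λ * ‖z - z'‖ := by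
          rw [Finset.sum_const, Finset.card_univ, nsmul_eq_mul, hΛ]
          ring
  refine ⟨B, Λ / (1 - M.γ), hB, by positivity, fun z z' π π' h h' hz hz' s =>
    ⟨hval z π h hz s, ?_⟩⟩
  have h1 := hback z z' π π' h h' hz hz'
  have h2 : (1 - M.γ) * (Λ / (1 - M.γ) * ‖z - z'‖) = Λ * ‖z - z'‖ := by field_simp
  have h3 := M.sub_le_value (τ := τ) (φ := φ) (μ := μ) h'.1.1 (v := M.value τ φ μ π)
    (δ := Λ / (1 - M.γ) * ‖z - z'‖) (fun s => by
      rw [h2]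
      linarith [(abs_le.1 (h1 s)).1]) s
  have h4 := M.value_le_add (τ := τ) (φ := φ) (μ := μ) h'.1.1 (v := M.value τ φ μ π)
    (δ := Λ / (1 - M.γ) * ‖z - z'‖) (fun s => by
      rw [h2]
      linarith [(abs_le.1 (h1 s)).2]) s
  rw [abs_le]
  constructor <;> linarith

end Existence

/-! ### Global existence of the flow -/

section Truncation

variable {S A : Type*} [Fintype S] [Fintype A]

/-- Truncation of all coordinates of `z` to `[-K, K]`. -/
def truncate (K : ℝ) (z : S → A → ℝ) : S → A → ℝ :=
  fun s a => max (-K) (min K (z s a))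

theorem norm_truncate_le {K : ℝ} (hK : 0 ≤ K) (z : S → A → ℝ) : ‖truncate K z‖ ≤ K := by
  refine (pi_norm_le_iff_of_nonneg hK).2 fun s => (pi_norm_le_iff_of_nonneg hK).2 fun a => ?_
  rw [Real.norm_eq_abs, abs_le]
  exact ⟨le_max_left _ _, max_le (by linarith) (min_le_left _ _)⟩

theorem norm_apply_apply_le (z : S → A → ℝ) (s : S) (a : A) : |z s a| ≤ ‖z‖ :=
  (norm_le_pi_norm (z s) a).trans (norm_le_pi_norm z s)

omit [Fintype S] [Fintype A] in
theorem abs_truncate_sub_le (K : ℝ) (z z' : S → A → ℝ) (s : S) (a : A) :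
    |truncate K z s a - truncate K z' s a| ≤ |z s a - z' s a| := by
  refine (abs_max_sub_max_le_max _ _ _ _).trans ?_
  rw [sub_self, abs_zero, max_eq_right (abs_nonneg _)]
  refine (abs_min_sub_min_le_max _ _ _ _).trans ?_
  rw [sub_self, abs_zero, max_eq_right (abs_nonneg _)]

theorem norm_truncate_sub_le (K : ℝ) (z z' : S → A → ℝ) :
    ‖truncate K z - truncate K z'‖ ≤ ‖z - z'‖ := by
  refine (pi_norm_le_iff_of_nonneg (norm_nonneg _)).2 fun s =>
    (pi_norm_le_iff_of_nonneg (norm_nonneg _)).2 fun a => ?_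
  exact (abs_truncate_sub_le K z z' s a).trans (norm_apply_apply_le (z - z') s a)

theorem truncate_eq_self {K : ℝ} {z : S → A → ℝ} (hz : ‖z‖ ≤ K) : truncate K z = z := by
  funext s a
  have := abs_le.1 ((norm_apply_apply_le z s a).trans hz)
  rw [truncate, min_eq_right this.2, max_eq_right this.1]

end Truncation

section GlobalFlow

variable {S A : Type*} [Fintype S] [DecidableEq S] [Fintype A] {φ : ℝ → ℝ}
  (hφ : IsEntropyFunction φ) {μ : S → A → ℝ} (hμ : IsPosPolicy μ) (M : MDP S A) {τ : ℝ}
  (hτ : 0 < τ)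

include hφ hμ hτ

/-- The equation `z' = -z + q / τ` for the dual variable, truncated outside of `‖z‖ ≤ K`, has a
forward solution for all times. -/
theorem exists_truncated_dual_solution {K : ℝ} (hK : 0 ≤ K) {p : (S → A → ℝ) → S → A → ℝ}
    (hp : ∀ z, IsMirrorImage φ μ z (p z)) (z₀ : S → A → ℝ) :
    ∃ z : ℝ → S → A → ℝ, z 0 = z₀ ∧ ∀ t : ℝ, 0 ≤ t → HasDerivWithinAt z (fun s a =>
      -truncate K (z t) s a + M.qValue (M.value τ φ μ (p (truncate K (z t)))) s a / τ)
      (Ici 0) t := by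
  obtain ⟨B, L, hB, hL, hBL⟩ := exists_bound_value_mirror hφ hμ M hτ hK
  have hγ0 := M.γ_pos
  have hval : ∀ z s, |M.value τ φ μ (p (truncate K z)) s| ≤ B := fun z =>
    fun s => (hBL _ _ _ _ (hp (truncate K z)) (hp (truncate K z)) (norm_truncate_le hK z)
      (norm_truncate_le hK z) s).1
  have hlip : ∀ z z' s, |M.value τ φ μ (p (truncate K z)) s -
      M.value τ φ μ (p (truncate K z')) s| ≤ L * ‖z - z'‖ := fun z z' s =>
    (hBL _ _ _ _ (hp (truncate K z)) (hp (truncate K z')) (norm_truncate_le hK z)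
      (norm_truncate_le hK z') s).2.trans
      (mul_le_mul_of_nonneg_left (norm_truncate_sub_le K z z') hL)
  set G : (S → A → ℝ) → S → A → ℝ := fun z s a =>
    -truncate K z s a + M.qValue (M.value τ φ μ (p (truncate K z))) s a / τ with hG
  set R := ∑ s, ∑ a, |M.r s a|
  have hR : 0 ≤ R := Finset.sum_nonneg fun _ _ => Finset.sum_nonneg fun _ _ => abs_nonneg _
  have hGb : ∀ z, ‖G z‖ ≤ K + (R + M.γ * B) / τ := by
    intro z
    refine (pi_norm_le_iff_of_nonneg (by positivity)).2 fun s =>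
      (pi_norm_le_iff_of_nonneg (by positivity)).2 fun a => ?_
    refine (abs_add_le _ _).trans (add_le_add ?_ ?_)
    · rw [abs_neg]
      exact (norm_apply_apply_le _ s a).trans (norm_truncate_le hK z)
    · rw [abs_div, abs_of_pos hτ]
      exact div_le_div_of_nonneg_right (M.abs_qValue_le (hval z) s a) hτ.le
  have hGl : ∀ z z', dist (G z) (G z') ≤ (1 + M.γ * L / τ) * dist z z' := by
    intro z z'
    rw [dist_eq_norm, dist_eq_norm]
    refine (pi_norm_le_iff_of_nonneg (by positivity)).2 fun s =>
      (pi_norm_le_iff_of_nonneg (by positivity)).2 fun a => ?_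
    have h1 := (abs_truncate_sub_le K z z' s a).trans (norm_apply_apply_le (z - z') s a)
    have h2 := M.abs_qValue_sub_le (hlip z z') s a
    have h3 : (G z - G z') s a = -(truncate K z s a - truncate K z' s a) +
        (M.qValue (M.value τ φ μ (p (truncate K z))) s a -
          M.qValue (M.value τ φ μ (p (truncate K z'))) s a) / τ := by
      simp only [hG, Pi.sub_apply]
      ring
    rw [h3, Real.norm_eq_abs]
    refine (abs_add_le _ _).trans ?_
    rw [abs_neg, abs_div, abs_of_pos hτ, add_mul, one_mul]
    refine add_le_add h1 ?_
    rw [div_le_iff₀ hτ]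
    refine h2.trans_eq ?_
    field_simp
  exact exists_forward_solution (G := G)
    (L := ⟨1 + M.γ * L / τ, by positivity⟩) (B := ⟨K + (R + M.γ * B) / τ, by positivity⟩)
    (LipschitzWith.of_dist_le_mul hGl) hGb z₀

/-- The flow exists globally. As long as the truncation is inactive, values increase and are bounded
above; hence `q / τ` is bounded by a constant that does not depend on the truncation, and so is the
dual variable, which relaxes towards it. The truncation level is never reached. -/
theorem MDP.exists_isQuasiNewtonFlow {π₀ : S → A → ℝ} (hπ₀ : IsPosPolicy π₀) :
    ∃ π : ℝ → S → A → ℝ, M.IsQuasiNewtonFlow τ φ μ π ∧ π 0 = π₀ := by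
  have hγ : 0 < 1 - M.γ := sub_pos.2 M.γ_lt_one
  have hγ0 := M.γ_pos
  choose p hp using exists_isMirrorImage hφ hμ
  set z₀ : S → A → ℝ := fun s a => deriv φ (π₀ s a / μ s a) with hz₀
  have hp0 : p z₀ = π₀ := (hp z₀).unique hφ hμ hπ₀.isMirrorImage
  set R := ∑ s, ∑ a, |M.r s a|
  have hR : 0 ≤ R := Finset.sum_nonneg fun _ _ => Finset.sum_nonneg fun _ _ => abs_nonneg _
  -- the values along the flow stay between those of `π₀` and `R / (1 - γ)`, hence below `B₀`
  set B₀ := ∑ s, |M.value τ φ μ π₀ s| + R / (1 - M.γ) with hB₀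
  have hV0 : 0 ≤ ∑ s, |M.value τ φ μ π₀ s| := Finset.sum_nonneg fun _ _ => abs_nonneg _
  have hB₀0 : 0 ≤ B₀ := by positivity
  set K₀ := max ‖z₀‖ ((R + M.γ * B₀) / τ) with hK₀
  have hK₀0 : 0 ≤ K₀ := (norm_nonneg _).trans (le_max_left _ _)
  obtain ⟨z, hz0, hz⟩ := exists_truncated_dual_solution hφ hμ M hτ
    (K := K₀ + 1) (by positivity) hp z₀
  have hflow : ∀ D : Set ℝ, D ⊆ Ici 0 → (∀ t ∈ D, ‖z t‖ ≤ K₀ + 1) → ∀ t ∈ D,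
      (∀ s a, HasDerivWithinAt (fun u => z u s a)
        (-z t s a + M.qValue (M.value τ φ μ (p (z t))) s a / τ) D t) ∧
      ∃ c : S → ℝ, ∀ s a, HasDerivWithinAt (fun u => p (z u) s a)
        (M.flowField τ φ μ (p (z t)) c s a) D t := by
    intro D hD hDK t ht
    have h1 := (hz t (hD ht)).mono hD
    rw [truncate_eq_self (hDK t ht)] at h1
    have h2 := fun s a => hasDerivWithinAt_pi.1 (hasDerivWithinAt_pi.1 h1 s) a
    exact ⟨h2, exists_hasDerivWithinAt_flowField hφ hμ M hτ ht (fun u _ => hp (z u)) h2⟩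
  have hstep : ∀ T : ℝ, 0 ≤ T → (∀ t ∈ Icc 0 T, ‖z t‖ ≤ K₀ + 1) → ‖z T‖ ≤ K₀ := by
    intro T hT hTK
    have hv : ∀ t ∈ Icc 0 T, ∀ s, |M.value τ φ μ (p (z t)) s| ≤ B₀ := by
      intro t ht s
      have h1 := M.value_le_value_of_flow hτ hφ hμ (π := fun u => p (z u)) ht.1 (fun u hu =>
        ⟨(hp (z u)).1, (hflow (Icc 0 t) (fun q hq => hq.1)
          (fun q hq => hTK q ⟨hq.1, hq.2.trans ht.2⟩) u hu).2⟩) s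
      have h2 := M.value_le hτ hφ hμ (hp (z t)).1 s
      have h3 : |M.value τ φ μ π₀ s| ≤ ∑ s, |M.value τ φ μ π₀ s| :=
        Finset.single_le_sum (f := fun s => |M.value τ φ μ π₀ s|) (fun _ _ => abs_nonneg _)
          (Finset.mem_univ s)
      have h4 := neg_abs_le (M.value τ φ μ π₀ s)
      have h5 : 0 ≤ R / (1 - M.γ) := by positivity
      simp only [hz0, hp0] at h1
      rw [abs_le]
      constructor <;> linarith
    refine (pi_norm_le_iff_of_nonneg hK₀0).2 fun s => (pi_norm_le_iff_of_nonneg hK₀0).2 fun a => ?_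
    refine abs_le_of_hasDerivWithinAt (u := fun t => z t s a)
      (f := fun t => M.qValue (M.value τ φ μ (p (z t))) s a / τ) hT
      (fun t ht => (hflow (Icc 0 T) (fun q hq => hq.1) hTK t ht).1 s a) (fun t ht => ?_) ?_
    · rw [abs_div, abs_of_pos hτ]
      exact (div_le_div_of_nonneg_right (M.abs_qValue_le (hv t ht) s a) hτ.le).trans
        (le_max_right _ _)
    · rw [hz0]
      exact (norm_apply_apply_le z₀ s a).trans (le_max_left _ _)
  have hcont : ContinuousOn (fun t => ‖z t‖) (Ici 0) :=
    ContinuousOn.norm fun t ht => (hz t ht).continuousWithinAt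
  have hbound : ∀ T : ℝ, 0 ≤ T → ‖z T‖ ≤ K₀ + 1 := by
    intro T hT
    by_contra! hlt
    -- the first time at which the norm is `K₀ + 1`
    set N := Icc 0 T ∩ (fun t => ‖z t‖) ⁻¹' {K₀ + 1} with hN
    have hIcc : Icc 0 T ⊆ Ici 0 := fun q hq => hq.1
    have hstart : ‖z 0‖ ≤ K₀ + 1 := by
      rw [hz0]
      linarith [le_max_left ‖z₀‖ ((R + M.γ * B₀) / τ)]
    have hNc : IsCompact N := isCompact_Icc.of_isClosed_subset
      ((hcont.mono hIcc).preimage_isClosed_of_isClosed isClosed_Icc isClosed_singleton)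
      inter_subset_left
    have hNne : N.Nonempty := by
      obtain ⟨t, ht, hte⟩ := intermediate_value_Icc hT (hcont.mono hIcc) ⟨hstart, hlt.le⟩
      exact ⟨t, ht, hte⟩
    obtain ⟨t₁, ⟨ht₁, ht₁e⟩, hleast⟩ := hNc.exists_isLeast hNne
    have h1 : ∀ t ∈ Icc 0 t₁, ‖z t‖ ≤ K₀ + 1 := by
      intro t ht
      by_contra! hgt
      obtain ⟨r, hr, hre⟩ := intermediate_value_Icc ht.1
        (hcont.mono fun q hq => hq.1) ⟨hstart, hgt.le⟩
      have hrt : r < t := lt_of_le_of_ne hr.2 fun h => by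
        rw [h] at hre
        exact hgt.ne' hre
      have := hleast ⟨⟨hr.1, hr.2.trans (ht.2.trans ht₁.2)⟩, hre⟩
      linarith [ht.2]
    have h2 := hstep t₁ ht₁.1 h1
    have h3 : ‖z t₁‖ = K₀ + 1 := ht₁e
    linarith
  refine ⟨fun t => p (z t), fun t ht => ⟨(hp (z t)).1, ?_⟩, by simp only [hz0, hp0]⟩
  exact (hflow (Ici 0) Subset.rfl (fun q hq => hbound q hq) t ht).2

end GlobalFlow

theorem theorem2p4 {S A : Type*} [Fintype S] [DecidableEq S] [Fintype A]
    (M : MDP S A) (τ : ℝ) (hτ : 0 < τ) (φ : ℝ → ℝ) (hφ : IsEntropyFunction φ)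
    (μ : S → A → ℝ) (hμ : IsPosPolicy μ) :
    ∃ πopt : S → A → ℝ,
      M.IsOptimal τ φ μ πopt ∧
      (∀ π' : S → A → ℝ, M.IsOptimal τ φ μ π' → π' = πopt) ∧
      (∀ π₀ : S → A → ℝ, IsPosPolicy π₀ →
        ∃ π : ℝ → S → A → ℝ, M.IsQuasiNewtonFlow τ φ μ π ∧ π 0 = π₀) ∧
      (∀ π : ℝ → S → A → ℝ, M.IsQuasiNewtonFlow τ φ μ π →
        Tendsto π atTop (𝓝 πopt)) := by
  obtain ⟨π, hπ, -⟩ := M.exists_isQuasiNewtonFlow hφ hμ hτ hμ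
  obtain ⟨ρ, hρ, -⟩ := hπ.exists_tendsto_greedy hφ hμ M hτ
  refine ⟨ρ, M.isOptimal_of_greedy hφ hμ hτ hρ, fun π' h => h.eq_of_greedy hφ hμ M hτ hρ,
    fun π₀ h => M.exists_isQuasiNewtonFlow hφ hμ hτ h, fun π' h => ?_⟩
  obtain ⟨ρ', hρ', hlim⟩ := h.exists_tendsto_greedy hφ hμ M hτ
  rwa [(M.isOptimal_of_greedy hφ hμ hτ hρ').eq_of_greedy hφ hμ M hτ hρ] at hlim
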